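/- Let $n\ge 2$ and $d\ge 1$ be integers, let $(\mathcal S,\mathcal B)$ be a measurable space, and let $\{X_i^{(1)}\}_{i=1}^n$, $\{X_i^{(2)}\}_{i=1}^n$ be $2n$ independent $\mathcal S$-valued random variables with common law $P$. Let $\mathbb H^d$ be the set of self-adjoint matrices in $\mathbb C^{d\times d}$, let $\|\cdot\|$ be the spectral norm, and for $i_1\neq i_2$ in $\{1,\dots,n\}$ let $H_{i_1,i_2}:\mathcal S\times\mathcal S\to\mathbb H^d$ be measurable kernels that are permutation-symmetric, i.e. $H_{i_1,i_2}(x_1,x_2)=H_{i_2,i_1}(x_2,x_1)$ for all $x_1,x_2$, and degenerate, i.e. $\mathbb E H_{i_1,i_2}(x,X_{i_2}^{(2)})$ exists and equals $0$ for every $x\in\mathcal S$. Let $\mathbb E_2$ denote the expectation with respect to $\{X_i^{(2)}\}_{i=1}^n$ only (conditionally on $\{X_i^{(1)}\}_{i=1}^n$). Then for all real $q\ge1$, with $r=\max(q,\log(ed))$, $$ \begin{aligned} &r^{3/2}\left(\mathbb E\max_{i_1}\left\|\sum_{i_2:\,i_2\ne i_1}H_{i_1,i_2}^2\big(X_{i_1}^{(1)},X_{i_2}^{(2)}\big)\right\|^q\right)^{1/(2q)}\\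 &\quad\le 4e\sqrt2\,\sqrt{1+\frac{\log d}{q}}\;\Bigg[\,r\left(\sum_{i_1}\mathbb E\left\|\sum_{i_2:\,i_2\ne i_1}\mathbb E_2H_{i_1,i_2}^2\big(X_{i_1}^{(1)},X_{i_2}^{(2)}\big)\right\|\right)^{1/2}\\ &\qquad\quad+r^{3/2}\left(\mathbb E\max_{i_1}\left\|\sum_{i_2:\,i_2\ne i_1}\mathbb E_2H_{i_1,i_2}^2\big(X_{i_1}^{(1)},X_{i_2}^{(2)}\big)\right\|^q\right)^{1/(2q)}\\ &\qquad\quad+r^{2}\left(\sum_{i_1}\mathbb E\max_{i_2:\,i_2\ne i_1}\left\|H_{i_1,i_2}^2\big(X_{i_1}^{(1)},X_{i_2}^{(2)}\big)\right\|^q\right)^{1/(2q)}\Bigg], \end{aligned} $$ where expectations of nonnegative quantities take values in $[0,\infty]$. -/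

import Mathlib

open MeasureTheory ProbabilityTheory
open scoped ENNReal Matrix.Norms.L2Operator

/-- `H i j : S × S → ℍ^d`, for `i ≠ j` in an index set of size `n`, is a family of measurable,
permutation-symmetric kernels with values in the self-adjoint `d × d` complex matrices which is
degenerate with respect to `P`, that is, `𝔼 H i j (x, ξ)` exists and vanishes for every point `x`,
where `ξ` has law `P`. The diagonal members `H i i` play no role and are unconstrained. -/
structure IsDegenerateKernelFamily {S : Type*} [MeasurableSpace S] (P : Measure S) {n d : ℕ}
    (H : Fin n → Fin n → S → S → Matrix (Fin d) (Fin d) ℂ) : Prop where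
  measurable_entry : ∀ i j, i ≠ j → ∀ a b, Measurable fun p : S × S => H i j p.1 p.2 a b
  isHermitian : ∀ i j, i ≠ j → ∀ x y, (H i j x y).IsHermitian
  symm : ∀ i j, i ≠ j → ∀ x y, H i j x y = H j i y x
  integrable : ∀ i j, i ≠ j → ∀ x, Integrable (fun y => H i j x y) P
  integral_eq_zero : ∀ i j, i ≠ j → ∀ x, ∫ y, H i j x y ∂P = 0

/-- The `2 * n` random variables `X k i` are independent and identically distributed with law `P`:
`X 0` is the first sample and `X 1` the second one, independent of the first. -/
structure IsIIDPairOfSamples {Ω S : Type*} [MeasurableSpace Ω] [MeasurableSpace S]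
    (μ : Measure Ω) (P : Measure S) {n : ℕ} (X : Fin 2 → Fin n → Ω → S) : Prop where
  hasLaw : ∀ k i, HasLaw (X k i) P μ
  iIndepFun : iIndepFun (fun p : Fin 2 × Fin n => X p.1 p.2) μ

/-- The expectation `𝔼₂` with respect to the second sample only: in `F (X 0) (X 1)`, the first
sample is kept at its value at `ω`, and the second one is integrated out. -/
noncomputable def expect₂ {Ω S E : Type*} [MeasurableSpace Ω] [NormedAddCommGroup E]
    [NormedSpace ℝ E] (μ : Measure Ω) {n : ℕ} (X : Fin 2 → Fin n → Ω → S)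
    (F : (Fin n → S) → (Fin n → S) → E) (ω : Ω) : E :=
  ∫ ω', F (fun i => X 0 i ω) (fun i => X 1 i ω') ∂μ

/-! ### Trace inequalities for pairs of Hermitian matrices -/

section MatrixKhintchine

open Matrix

/-! Freeze the first sample. For fixed `i₁` and `X 0 i₁ = x`, the inner sum is a sum of squares of
independent Hermitian matrices, and the matrix Rosenthal inequality `lintegral_enorm_sum_sq_rpow_le`
bounds the `2q`-th root of its `q`-th moment by `‖∑ 𝔼₂ H²‖^(1/2)` plus a multiple of `√r` times the
corresponding root for the maximal summand. That inequality comes from symmetrization and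
noncommutative Khintchine applied to the matrices `H²`: since `‖∑ H⁴‖ ≤ max ‖H²‖ · ‖∑ H²‖`,
Cauchy-Schwarz brings the moment being estimated back to the right side, and a quadratic inequality
is solved for it.

Khintchine itself is proved by flipping one sign at a time: the change in the trace of a power is
controlled by a mean value inequality for traces, which lowers the exponent by two at each step.

Next, the maximum over `i₁` is bounded by the sum over `i₁`, and the Rosenthal bound is integrated
over the first sample. The last term of the theorem appears directly, but the variance term is now a
sum of `q`-th moments, `∑ 𝔼 ξᵢ^q` with `ξᵢ = ‖∑ 𝔼₂ H²‖`. The `ξᵢ` are functions of independent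
variables, so the reverse maximal inequality `rpow_mul_sum_lintegral_rpow_le` replaces this sum by
`𝔼 max ξᵢ^q` and `(∑ 𝔼 ξᵢ)^q`, which are the other two terms. The price is `(4r)^(1/(2q))`, and this
is where `√(1 + log d / q)` comes from. -/

theorem sum_pow_mul_pow_le (a b : ℝ) {m : ℕ} (hm : Even m) :
    ∑ i ∈ Finset.range (m + 1), a ^ i * b ^ (m - i) ≤ (m + 1) / 2 * (a ^ m + b ^ m) := by
  have h := Finset.sum_range_reflect (fun i => a ^ i * b ^ (m - i)) (m + 1)
  have hle : ∑ i ∈ Finset.range (m + 1),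
      (a ^ i * b ^ (m - i) + a ^ (m + 1 - 1 - i) * b ^ (m - (m + 1 - 1 - i))) ≤
      ∑ i ∈ Finset.range (m + 1), (a ^ m + b ^ m) := by
    refine Finset.sum_le_sum fun i hi => ?_
    have hi' : i ≤ m := Nat.lt_succ_iff.1 (Finset.mem_range.1 hi)
    rw [Nat.add_sub_cancel, Nat.sub_sub_self hi']
    -- Rearrangement for the paired terms `i` and `m - i`: both powers order `|a|` and `|b|` the
    -- same way. Evenness of `m` then removes the absolute values from `|a|^m` and `|b|^m`.
    have hpos : 0 ≤ (|a| ^ i - |b| ^ i) * (|a| ^ (m - i) - |b| ^ (m - i)) := by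
      rcases le_total |a| |b| with hab | hab
      · exact mul_nonneg_of_nonpos_of_nonpos
          (sub_nonpos.2 (pow_le_pow_left₀ (abs_nonneg _) hab _))
          (sub_nonpos.2 (pow_le_pow_left₀ (abs_nonneg _) hab _))
      · exact mul_nonneg
          (sub_nonneg.2 (pow_le_pow_left₀ (abs_nonneg _) hab _))
          (sub_nonneg.2 (pow_le_pow_left₀ (abs_nonneg _) hab _))
    have ha : |a| ^ i * |a| ^ (m - i) = a ^ m := by
      rw [← pow_add, Nat.add_sub_cancel' hi', hm.pow_abs]
    have hb : |b| ^ i * |b| ^ (m - i) = b ^ m := by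
      rw [← pow_add, Nat.add_sub_cancel' hi', hm.pow_abs]
    have h1 : a ^ i * b ^ (m - i) ≤ |a| ^ i * |b| ^ (m - i) := by
      rw [← abs_pow, ← abs_pow, ← abs_mul]; exact le_abs_self _
    have h2 : a ^ (m - i) * b ^ i ≤ |a| ^ (m - i) * |b| ^ i := by
      rw [← abs_pow, ← abs_pow, ← abs_mul]; exact le_abs_self _
    nlinarith
  rw [Finset.sum_add_distrib, h, Finset.sum_const, Finset.card_range, nsmul_eq_mul] at hle
  push_cast at hle
  linarith

theorem sub_mul_pow_succ_sub_le (a b : ℝ) {m : ℕ} (hm : Even m) :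
    (a - b) * (a ^ (m + 1) - b ^ (m + 1)) ≤ (m + 1) / 2 * ((a - b) ^ 2 * (a ^ m + b ^ m)) := by
  have h := geom_sum₂_mul a b (m + 1)
  rw [← h, Nat.add_sub_cancel]
  nlinarith [mul_le_mul_of_nonneg_left (sum_pow_mul_pow_le a b hm) (sq_nonneg (a - b))]

variable {m : Type*} [Fintype m] [DecidableEq m]

theorem Matrix.IsHermitian.pow_eq_conj {X : Matrix m m ℂ} (hX : X.IsHermitian) (k : ℕ) :
    X ^ k = (hX.eigenvectorUnitary : Matrix m m ℂ) *
      diagonal (fun i => ((hX.eigenvalues i ^ k : ℝ) : ℂ)) *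
      star (hX.eigenvectorUnitary : Matrix m m ℂ) := by
  conv_lhs => rw [hX.spectral_theorem, ← map_pow, diagonal_pow, Unitary.conjStarAlgAut_apply]
  congr 3
  ext i
  simp

/-- The joint spectral decomposition of a pair of Hermitian matrices, seen through traces. -/
theorem exists_re_trace_pow_mul_pow {X Y : Matrix m m ℂ} (hX : X.IsHermitian)
    (hY : Y.IsHermitian) : ∃ (x y : m → ℝ) (w : m → m → ℝ), (∀ i j, 0 ≤ w i j) ∧
      ∀ k l : ℕ, (X ^ k * Y ^ l).trace.re = ∑ i, ∑ j, w i j * (x i ^ k * y j ^ l) := by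
  set U := (hX.eigenvectorUnitary : Matrix m m ℂ)
  set V := (hY.eigenvectorUnitary : Matrix m m ℂ)
  -- The weight is the squared modulus of the inner product of the `i`-th eigenvector of `X` with
  -- the `j`-th eigenvector of `Y`.
  refine ⟨hX.eigenvalues, hY.eigenvalues, fun i j => Complex.normSq ((star U * V) i j),
    fun i j => Complex.normSq_nonneg _, fun k l => ?_⟩
  rw [hX.pow_eq_conj, hY.pow_eq_conj]
  change (U * diagonal _ * star U * (V * diagonal _ * star V)).trace.re = _
  have : (U * diagonal (fun i => ((hX.eigenvalues i ^ k : ℝ) : ℂ)) * star U *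
      (V * diagonal (fun i => ((hY.eigenvalues i ^ l : ℝ) : ℂ)) * star V)).trace =
      (diagonal (fun i => ((hX.eigenvalues i ^ k : ℝ) : ℂ)) * (star U * V) *
       (diagonal (fun i => ((hY.eigenvalues i ^ l : ℝ) : ℂ)) * star (star U * V))).trace := by
    rw [star_mul, star_star, mul_assoc U, mul_assoc U, trace_mul_comm U]
    simp only [mul_assoc]
  rw [this, trace, Complex.re_sum]
  refine Finset.sum_congr rfl fun i _ => ?_
  rw [diag_apply, mul_apply, Complex.re_sum]
  refine Finset.sum_congr rfl fun j _ => ?_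
  rw [diagonal_mul, diagonal_mul, star_apply, Complex.star_def]
  rw [show ∀ a b c : ℂ, a * c * (b * (starRingEnd ℂ) c) = (c * (starRingEnd ℂ) c) * (a * b) by
    intros; ring, Complex.mul_conj, ← Complex.ofReal_mul, ← Complex.ofReal_mul, Complex.ofReal_re]

/-- Mean value inequality for traces. By cyclicity every word that occurs can be sorted into the
form `X ^ k * Y ^ l`, so both sides are averages of scalar expressions over pairs of eigenvalues
with the same nonnegative weights, and the scalar inequality applies termwise. -/
theorem re_trace_sub_mul_pow_succ_sub_le {X Y : Matrix m m ℂ} (hX : X.IsHermitian)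
    (hY : Y.IsHermitian) {k : ℕ} (hk : Even k) :
    ((X - Y) * (X ^ (k + 1) - Y ^ (k + 1))).trace.re ≤
      (k + 1) / 2 * ((X - Y) ^ 2 * (X ^ k + Y ^ k)).trace.re := by
  obtain ⟨x, y, w, hw, h⟩ := exists_re_trace_pow_mul_pow hX hY
  have e1 : ((X - Y) * (X ^ (k + 1) - Y ^ (k + 1))).trace.re =
      ∑ i, ∑ j, w i j * ((x i - y j) * (x i ^ (k + 1) - y j ^ (k + 1))) := by
    have : ((X - Y) * (X ^ (k + 1) - Y ^ (k + 1))).trace =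
        (X ^ (k + 2) * Y ^ 0).trace - (X ^ 1 * Y ^ (k + 1)).trace
          - (X ^ (k + 1) * Y ^ 1).trace + (X ^ 0 * Y ^ (k + 2)).trace := by
      rw [trace_mul_comm (X ^ (k + 1)) (Y ^ 1), sub_mul, mul_sub, mul_sub, ← pow_succ',
        ← pow_succ']
      simp only [trace_sub, pow_zero, mul_one, one_mul, pow_one]
      ring
    rw [this]
    simp only [Complex.add_re, Complex.sub_re, h, ← Finset.sum_add_distrib,
      ← Finset.sum_sub_distrib]
    refine Finset.sum_congr rfl fun i _ => Finset.sum_congr rfl fun j _ => ?_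
    ring
  have e2 : ((X - Y) ^ 2 * (X ^ k + Y ^ k)).trace.re =
      ∑ i, ∑ j, w i j * ((x i - y j) ^ 2 * (x i ^ k + y j ^ k)) := by
    have : ((X - Y) ^ 2 * (X ^ k + Y ^ k)).trace =
        (X ^ (k + 2) * Y ^ 0).trace - 2 * (X ^ (k + 1) * Y ^ 1).trace
          + (X ^ k * Y ^ 2).trace + ((X ^ 2 * Y ^ k).trace
            - 2 * (X ^ 1 * Y ^ (k + 1)).trace + (X ^ 0 * Y ^ (k + 2)).trace) := by
      have c1 : (Y ^ 2 * X ^ k).trace = (X ^ k * Y ^ 2).trace := trace_mul_comm _ _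
      have c2 : (X * Y * X ^ k).trace = (X ^ (k + 1) * Y).trace := by
        rw [trace_mul_comm, ← mul_assoc, ← pow_succ]
      have c3 : (Y * X * X ^ k).trace = (X ^ (k + 1) * Y).trace := by
        rw [mul_assoc, ← pow_succ', trace_mul_comm]
      have c4 : (Y * X * Y ^ k).trace = (X * Y ^ (k + 1)).trace := by
        rw [mul_assoc, trace_mul_comm, mul_assoc, ← pow_succ]
      have c5 : (X * Y * Y ^ k).trace = (X * Y ^ (k + 1)).trace := by
        rw [mul_assoc, ← pow_succ']
      have c6 : (X * X * X ^ k).trace = (X ^ (k + 2)).trace := by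
        rw [mul_assoc, ← pow_succ', ← pow_succ']
      have c7 : (Y * Y * Y ^ k).trace = (Y ^ (k + 2)).trace := by
        rw [mul_assoc, ← pow_succ', ← pow_succ']
      rw [← c1]
      simp only [pow_two X, pow_two Y, pow_two (X - Y), sub_mul, mul_sub, mul_add, trace_sub,
        trace_add, c2, c3, c4, c5, c6, c7, pow_zero, mul_one, one_mul, pow_one]
      ring
    rw [this]
    simp only [Complex.add_re, Complex.sub_re, Complex.mul_re, Complex.re_ofNat, Complex.im_ofNat,
      zero_mul, sub_zero, h, Finset.mul_sum, ← Finset.sum_add_distrib, ← Finset.sum_sub_distrib]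
    refine Finset.sum_congr rfl fun i _ => Finset.sum_congr rfl fun j _ => ?_
    ring
  rw [e1, e2, Finset.mul_sum]
  refine Finset.sum_le_sum fun i _ => ?_
  rw [Finset.mul_sum]
  refine Finset.sum_le_sum fun j _ => ?_
  have := mul_le_mul_of_nonneg_left (sub_mul_pow_succ_sub_le (x i) (y j) hk) (hw i j)
  linarith

theorem norm_entry_le_l2_opNorm (B : Matrix m m ℂ) (i j : m) : ‖B i j‖ ≤ ‖B‖ := by
  have h := B.l2_opNorm_mulVec (EuclideanSpace.single j 1)
  rw [PiLp.norm_single, norm_one, mul_one] at h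
  refine le_trans ?_ ((PiLp.norm_apply_le _ i).trans h)
  simp

/-- In an eigenbasis of `X` the trace is a combination of diagonal entries of the rotated `B`, each
at most `‖B‖` in modulus, with coefficients that are even powers of eigenvalues, hence nonnegative.
-/
theorem re_trace_mul_pow_le {X : Matrix m m ℂ} (hX : X.IsHermitian) (B : Matrix m m ℂ) {k : ℕ}
    (hk : Even k) : (B * X ^ k).trace.re ≤ ‖B‖ * (X ^ k).trace.re := by
  have hU : star (hX.eigenvectorUnitary : Matrix m m ℂ) * hX.eigenvectorUnitary = 1 :=
    Unitary.coe_star_mul_self _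
  set U := (hX.eigenvectorUnitary : Matrix m m ℂ) with hUdef
  have e1 : (B * X ^ k).trace =
      (star U * B * U * diagonal (fun i => ((hX.eigenvalues i ^ k : ℝ) : ℂ))).trace := by
    rw [hX.pow_eq_conj, ← hUdef, ← mul_assoc, trace_mul_comm]
    simp only [mul_assoc]
  have e2 : (X ^ k).trace = (diagonal (fun i => ((hX.eigenvalues i ^ k : ℝ) : ℂ))).trace := by
    rw [hX.pow_eq_conj, ← hUdef, trace_mul_comm, ← mul_assoc, hU, one_mul]
  have hn : ‖star U * B * U‖ = ‖B‖ := by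
    rw [hUdef, CStarRing.norm_mul_coe_unitary, ← Unitary.coe_star, CStarRing.norm_coe_unitary_mul]
  rw [e1, e2, trace, trace, Complex.re_sum, Complex.re_sum, Finset.mul_sum]
  refine Finset.sum_le_sum fun i _ => ?_
  rw [diag_apply, diag_apply, mul_diagonal, diagonal_apply_eq, Complex.re_mul_ofReal,
    Complex.ofReal_re]
  refine mul_le_mul_of_nonneg_right ?_ (hk.pow_nonneg _)
  exact (Complex.re_le_norm _).trans ((norm_entry_le_l2_opNorm _ i i).trans hn.le)

theorem norm_pow_le_re_trace {X : Matrix m m ℂ} (hX : X.IsHermitian) {k : ℕ}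
    (hk : Even k) (hk0 : k ≠ 0) : ‖X‖ ^ k ≤ (X ^ k).trace.re := by
  have hU : star (hX.eigenvectorUnitary : Matrix m m ℂ) * hX.eigenvectorUnitary = 1 :=
    Unitary.coe_star_mul_self _
  have hn : ‖X‖ = ‖hX.eigenvalues‖ := by
    have h := congrArg norm (hX.pow_eq_conj 1)
    rw [pow_one, ← Unitary.coe_star, CStarRing.norm_mul_coe_unitary,
      CStarRing.norm_coe_unitary_mul, l2_opNorm_diagonal] at h
    rw [h]
    simp [Pi.norm_def]
  have e2 : (X ^ k).trace.re = ∑ i, hX.eigenvalues i ^ k := by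
    rw [hX.pow_eq_conj, trace_mul_comm, ← mul_assoc, hU, one_mul, trace, Complex.re_sum]
    refine Finset.sum_congr rfl fun i _ => ?_
    rw [diag_apply, diagonal_apply_eq, Complex.ofReal_re]
  rw [hn, e2]
  rcases isEmpty_or_nonempty m with hm | hm
  -- In dimension zero the trace vanishes, so `0 ^ 0 = 1` has to be excluded.
  · rw [Subsingleton.elim hX.eigenvalues 0, norm_zero, zero_pow hk0]
    simp
  · obtain ⟨i, hi⟩ := Finite.exists_max fun i => ‖hX.eigenvalues i‖
    refine (pow_le_pow_left₀ (norm_nonneg _)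
      ((pi_norm_le_iff_of_nonneg (norm_nonneg _)).2 hi) k).trans ?_
    rw [Real.norm_eq_abs, hk.pow_abs]
    exact Finset.single_le_sum (f := fun i => hX.eigenvalues i ^ k)
      (fun i _ => hk.pow_nonneg _) (Finset.mem_univ i)

end MatrixKhintchine

/-! ### Noncommutative Khintchine inequality by sign flips -/

section Signs

open Matrix

theorem Matrix.IsHermitian.intUnits_smul {m : Type*} {A : Matrix m m ℂ}
    (hA : A.IsHermitian) (e : ℤˣ) :
    (e • A).IsHermitian := by
  rcases Int.units_eq_one_or e with rfl | rfl
  · rwa [one_smul]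
  · rw [Units.neg_smul, one_smul]; exact hA.neg

theorem Matrix.isHermitian_signed_sum {m ι : Type*} [Fintype ι] {A : ι → Matrix m m ℂ}
    (hA : ∀ i, (A i).IsHermitian) (ε : ι → ℤˣ) : (∑ i, ε i • A i).IsHermitian := by
  rw [IsHermitian, conjTranspose_sum]
  exact Finset.sum_congr rfl fun i _ => (hA i).intUnits_smul (ε i)

variable {m : Type*} [Fintype m] [DecidableEq m] {ι : Type*} [Fintype ι]

/-- Negation of the sign with index `i`. -/
def negSignAt [DecidableEq ι] (i : ι) : Equiv.Perm (ι → ℤˣ) :=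
  Function.Involutive.toPerm (fun ε => Function.update ε i (-ε i)) fun ε => by simp

theorem signed_sum_sub_negSignAt [DecidableEq ι] {E : Type*} [AddCommGroup E] (A : ι → E)
    (ε : ι → ℤˣ) (i : ι) :
    ∑ j, ε j • A j - ∑ j, negSignAt i ε j • A j = 2 • (ε i • A i) := by
  rw [← Finset.sum_sub_distrib, Finset.sum_eq_single i]
  · change ε i • A i - Function.update ε i (-ε i) i • A i = _
    rw [Function.update_self, Units.neg_smul, sub_neg_eq_add, two_smul]
  · intro j _ hj
    change ε j • A j - Function.update ε i (-ε i) j • A j = _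
    rw [Function.update_of_ne hj, sub_self]
  · simp

/-- Flipping the `i`-th sign permutes the sign vectors, so the left side can be antisymmetrized into
`(X - X') * (X ^ (k+1) - X' ^ (k+1))`, where `X - X'` is twice the `i`-th summand. The trace mean
value inequality then applies, with `(X - X')² = 4 Aᵢ²`. -/
theorem sum_sign_re_trace_mul_pow_le [DecidableEq ι] {A : ι → Matrix m m ℂ}
    (hA : ∀ i, (A i).IsHermitian)
    {k : ℕ} (hk : Even k) (i : ι) :
    ∑ ε : ι → ℤˣ, ((ε i • A i) * (∑ j, ε j • A j) ^ (k + 1)).trace.re ≤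
      (k + 1) * ∑ ε : ι → ℤˣ, (A i ^ 2 * (∑ j, ε j • A j) ^ k).trace.re := by
  set X : (ι → ℤˣ) → Matrix m m ℂ := fun ε => ∑ j, ε j • A j with hXdef
  have hX : ∀ ε, (X ε).IsHermitian := isHermitian_signed_sum hA
  have hsub : ∀ ε, X ε - X (negSignAt i ε) = 2 • (ε i • A i) := fun ε =>
    signed_sum_sub_negSignAt A ε i
  have hsq : ∀ ε, (X ε - X (negSignAt i ε)) ^ 2 = 4 • A i ^ 2 := fun ε => by
    rw [hsub, smul_pow]
    rcases Int.units_eq_one_or (ε i) with h | h <;> rw [h] <;> simp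
  have hflip : ∀ f : (ι → ℤˣ) → ℝ, ∑ ε, f (negSignAt i ε) = ∑ ε, f ε := fun f =>
    Equiv.sum_comp (negSignAt i) f
  have hval : ∀ ε, negSignAt i ε i = -ε i := fun ε => by
    change Function.update ε i (-ε i) i = _
    rw [Function.update_self]
  have hl : 4 * ∑ ε, ((ε i • A i) * X ε ^ (k + 1)).trace.re =
      ∑ ε, ((X ε - X (negSignAt i ε)) * (X ε ^ (k + 1) - X (negSignAt i ε) ^ (k + 1))).trace.re := by
    have h1 := hflip fun ε => ((ε i • A i) * X ε ^ (k + 1)).trace.re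
    have : ∀ ε, ((X ε - X (negSignAt i ε)) *
        (X ε ^ (k + 1) - X (negSignAt i ε) ^ (k + 1))).trace.re =
        2 * ((ε i • A i) * X ε ^ (k + 1)).trace.re +
          2 * ((negSignAt i ε i • A i) * X (negSignAt i ε) ^ (k + 1)).trace.re := fun ε => by
      rw [hsub, hval, Units.neg_smul, two_smul]
      simp only [add_mul, mul_sub, neg_mul, trace_add, trace_sub, trace_neg, Complex.add_re,
        Complex.sub_re, Complex.neg_re]
      ring
    rw [Finset.sum_congr rfl fun ε _ => this ε, Finset.sum_add_distrib, ← Finset.mul_sum,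
      ← Finset.mul_sum, h1]
    ring
  have hr : 2 * ∑ ε, (4 • A i ^ 2 * X ε ^ k).trace.re =
      ∑ ε, ((X ε - X (negSignAt i ε)) ^ 2 * (X ε ^ k + X (negSignAt i ε) ^ k)).trace.re := by
    have h1 := hflip fun ε => (4 • A i ^ 2 * X ε ^ k).trace.re
    simp only [hsq, mul_add, trace_add, Complex.add_re, Finset.sum_add_distrib]
    rw [h1]
    ring
  have h4 : ∀ ε, (4 • A i ^ 2 * X ε ^ k).trace.re = 4 * (A i ^ 2 * X ε ^ k).trace.re := fun ε => by
    rw [smul_mul_assoc, trace_smul]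
    simp
  have hle := Finset.sum_le_sum fun ε (_ : ε ∈ Finset.univ) =>
    re_trace_sub_mul_pow_succ_sub_le (hX ε) (hX (negSignAt i ε)) hk
  rw [← hl, ← Finset.mul_sum, ← hr] at hle
  simp only [h4] at hle
  rw [← Finset.mul_sum] at hle
  linarith

theorem sum_sign_re_trace_pow_add_two_le [DecidableEq ι] {A : ι → Matrix m m ℂ}
    (hA : ∀ i, (A i).IsHermitian)
    {k : ℕ} (hk : Even k) :
    ∑ ε : ι → ℤˣ, ((∑ j, ε j • A j) ^ (k + 2)).trace.re ≤
      (k + 1) * ‖∑ i, A i ^ 2‖ * ∑ ε : ι → ℤˣ, ((∑ j, ε j • A j) ^ k).trace.re := by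
  calc ∑ ε : ι → ℤˣ, ((∑ j, ε j • A j) ^ (k + 2)).trace.re
      = ∑ i, ∑ ε : ι → ℤˣ, ((ε i • A i) * (∑ j, ε j • A j) ^ (k + 1)).trace.re := by
        rw [Finset.sum_comm]
        refine Finset.sum_congr rfl fun ε _ => ?_
        rw [pow_succ' _ (k + 1), Finset.sum_mul, trace_sum, Complex.re_sum]
    _ ≤ ∑ i, (k + 1) * ∑ ε : ι → ℤˣ, (A i ^ 2 * (∑ j, ε j • A j) ^ k).trace.re :=
        Finset.sum_le_sum fun i _ => sum_sign_re_trace_mul_pow_le hA hk i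
    _ = (k + 1) * ∑ ε : ι → ℤˣ, ((∑ i, A i ^ 2) * (∑ j, ε j • A j) ^ k).trace.re := by
        rw [← Finset.mul_sum, Finset.sum_comm]
        congr 1
        refine Finset.sum_congr rfl fun ε _ => ?_
        rw [Finset.sum_mul, trace_sum, Complex.re_sum]
    _ ≤ (k + 1) * ∑ ε : ι → ℤˣ, ‖∑ i, A i ^ 2‖ * ((∑ j, ε j • A j) ^ k).trace.re := by
        gcongr with ε
        exact re_trace_mul_pow_le (isHermitian_signed_sum hA ε) _ hk
    _ = _ := by rw [← Finset.mul_sum, mul_assoc]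

/-- **Noncommutative Khintchine inequality**, for even moments. -/
theorem sum_sign_norm_pow_le [DecidableEq ι] {A : ι → Matrix m m ℂ}
    (hA : ∀ i, (A i).IsHermitian) {p : ℕ}
    (hp : p ≠ 0) :
    ∑ ε : ι → ℤˣ, ‖∑ j, ε j • A j‖ ^ (2 * p) ≤
      2 ^ Fintype.card ι * (Fintype.card m * ((2 * p - 1) * ‖∑ i, A i ^ 2‖) ^ p) := by
  have hpos : ∀ k : ℕ, Even k → 0 ≤ ∑ ε : ι → ℤˣ, ((∑ j, ε j • A j) ^ k).trace.re := by
    intro k hk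
    refine Finset.sum_nonneg fun ε _ => ?_
    rcases eq_or_ne k 0 with rfl | h0
    · simp
    · exact (by positivity : (0 : ℝ) ≤ ‖∑ j, ε j • A j‖ ^ k).trans
        (norm_pow_le_re_trace (isHermitian_signed_sum hA ε) hk h0)
  -- Each step costs `2l + 1`, which is rounded up to `2p - 1` so that the product becomes a power;
  -- the dimension enters only as the trace of the identity at `l = 0`.
  have hind : ∀ l ≤ p, ∑ ε : ι → ℤˣ, ((∑ j, ε j • A j) ^ (2 * l)).trace.re ≤
      2 ^ Fintype.card ι * (Fintype.card m * ((2 * p - 1) * ‖∑ i, A i ^ 2‖) ^ l) := by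
    intro l
    induction l with
    | zero => simp
    | succ l ih =>
      intro hl
      have h := sum_sign_re_trace_pow_add_two_le hA (even_two_mul l)
      have hlp : ((2 * l : ℕ) : ℝ) + 1 ≤ 2 * p - 1 := by
        have : (l : ℝ) + 1 ≤ p := by exact_mod_cast hl
        push_cast
        linarith
      refine h.trans ((mul_le_mul_of_nonneg_right (mul_le_mul_of_nonneg_right hlp
        (norm_nonneg _)) (hpos _ (even_two_mul l))).trans ?_)
      refine (mul_le_mul_of_nonneg_left (ih (by omega)) ?_).trans (le_of_eq (by ring))
      exact mul_nonneg (by have : (0 : ℝ) ≤ (2 * l : ℕ) := by positivity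
                           linarith) (norm_nonneg _)
  exact (Finset.sum_le_sum fun ε _ => norm_pow_le_re_trace (isHermitian_signed_sum hA ε)
    (even_two_mul p) (by omega)).trans (hind p le_rfl)

open scoped MatrixOrder in
/-- For a Hermitian family, `‖∑ Aᵢ⁴‖ ≤ max ‖Aᵢ²‖ ‖∑ Aᵢ²‖`. -/
theorem norm_sum_sq_sq_le {A : ι → Matrix m m ℂ} (hA : ∀ i, (A i).IsHermitian) {b : ℝ}
    (hb : ∀ i, ‖A i ^ 2‖ ≤ b) : ‖∑ i, (A i ^ 2) ^ 2‖ ≤ b * ‖∑ i, A i ^ 2‖ := by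
  have hsa : ∀ i, star (A i) = A i := hA
  have hb0 : ∀ i, 0 ≤ A i ^ 2 := fun i => by
    have := star_mul_self_nonneg (A i)
    rwa [hsa, ← pow_two] at this
  rcases isEmpty_or_nonempty ι with hι | ⟨⟨i₀⟩⟩
  · simp
  have hbnn : 0 ≤ b := (norm_nonneg _).trans (hb i₀)
  have h0 : 0 ≤ ∑ i, (A i ^ 2) ^ 2 := Finset.sum_nonneg fun i _ => by
    have := star_mul_self_nonneg (A i ^ 2)
    rwa [star_pow, hsa, ← pow_two] at this
  have hle : ∑ i, (A i ^ 2) ^ 2 ≤ b • ∑ i, A i ^ 2 := by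
    rw [Finset.smul_sum]
    refine Finset.sum_le_sum fun i _ => ?_
    have hs : IsSelfAdjoint (A i ^ 2) := by
      rw [IsSelfAdjoint, star_pow, hsa]
    have h := CStarAlgebra.star_left_conjugate_le_norm_smul (a := A i) (b := A i ^ 2) hs
    rw [hsa, ← pow_two, show A i * A i ^ 2 * A i = (A i ^ 2) ^ 2 by
      simp only [pow_two, mul_assoc]] at h
    exact h.trans (smul_le_smul_of_nonneg_right (hb i) (hb0 i))
  refine (CStarAlgebra.norm_le_norm_of_nonneg_of_le h0 hle).trans ?_
  rw [norm_smul, Real.norm_of_nonneg hbnn]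

end Signs

/-! ### Khintchine for real moments -/

section SignAverage

variable {m : Type*} [Fintype m] [DecidableEq m] {ι : Type*} [Fintype ι]

/-- Passing from an average moment of even order `2 * p` to one of smaller real order `q`. -/
theorem sum_rpow_le_of_sum_pow_le {κ : Type*} [Fintype κ] [Nonempty κ] {a : κ → ℝ}
    (ha : ∀ i, 0 ≤ a i) {q : ℝ} (hq : 0 < q) {p : ℕ} (hqp : q ≤ 2 * p) {C : ℝ} (hC : 0 ≤ C)
    (h : ∑ i, a i ^ (2 * p) ≤ Fintype.card κ * C ^ p) :
    ∑ i, a i ^ q ≤ Fintype.card κ * C ^ (q / 2) := by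
  have hp : (0 : ℝ) < p := by linarith
  set N := (Fintype.card κ : ℝ) with hN
  have hNpos : 0 < N := by rw [hN]; exact_mod_cast Fintype.card_pos
  -- Jensen for the uniform average, with exponent `2p / q ≥ 1`.
  have hJ := Real.rpow_arith_mean_le_arith_mean_rpow Finset.univ
    (fun _ : κ => N⁻¹) (fun i => a i ^ q) (fun _ _ => by positivity)
    (by rw [Finset.sum_const, Finset.card_univ, nsmul_eq_mul]
        exact mul_inv_cancel₀ hNpos.ne') (fun i _ => Real.rpow_nonneg (ha i) _)
    (p := 2 * p / q) (by rw [le_div_iff₀ hq]; linarith)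
  have hpow : ∀ i, (a i ^ q) ^ (2 * p / q : ℝ) = a i ^ (2 * p) := fun i => by
    rw [← Real.rpow_mul (ha i), mul_div_cancel₀ _ hq.ne', ← Real.rpow_natCast]
    push_cast
    rfl
  simp only [hpow] at hJ
  rw [← Finset.mul_sum, ← Finset.mul_sum] at hJ
  have hT0 : 0 ≤ ∑ i, a i ^ q := Finset.sum_nonneg fun i _ => Real.rpow_nonneg (ha i) _
  have hbound : (N⁻¹ * ∑ i, a i ^ q) ^ (2 * p / q : ℝ) ≤ C ^ p := by
    refine hJ.trans ?_
    rwa [inv_mul_le_iff₀ hNpos]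
  have h := Real.rpow_le_rpow (by positivity) hbound (z := q / (2 * p)) (by positivity)
  rw [← Real.rpow_mul (by positivity), ← Real.rpow_natCast, ← Real.rpow_mul hC,
    show (2 * p / q : ℝ) * (q / (2 * p)) = 1 by field_simp,
    show (p : ℝ) * (q / (2 * p)) = q / 2 by field_simp, Real.rpow_one,
    inv_mul_le_iff₀ hNpos] at h
  exact h

/-- Noncommutative Khintchine inequality for real moments, with dimension-free constant once
`r` dominates both the order of the moment and the logarithm of the dimension. -/
theorem sum_sign_norm_rpow_le [DecidableEq ι] {B : ι → Matrix m m ℂ}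
    (hB : ∀ i, (B i).IsHermitian) {q r : ℝ} (hq : 1 ≤ q) (hqr : q ≤ r)
    (hr : (Fintype.card m : ℝ) ≤ Real.exp r) :
    ∑ ε : ι → ℤˣ, ‖∑ j, ε j • B j‖ ^ q ≤
      2 ^ Fintype.card ι * (3 * Real.exp 1 * r * ‖∑ i, B i ^ 2‖) ^ (q / 2) := by
  have hr1 : 1 ≤ r := hq.trans hqr
  have hrp : r ≤ ⌈r⌉₊ := Nat.le_ceil r
  have hpr : (⌈r⌉₊ : ℝ) < r + 1 := Nat.ceil_lt_add_one (by linarith)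
  generalize ⌈r⌉₊ = p at hrp hpr
  have hp0 : p ≠ 0 := by
    rintro rfl
    rw [Nat.cast_zero] at hrp
    linarith
  have hK := sum_sign_norm_pow_le hB hp0
  have hs0 : 0 ≤ ‖∑ i, B i ^ 2‖ := norm_nonneg _
  generalize ‖∑ i, B i ^ 2‖ = s at hK hs0 ⊢
  have hcard : (Fintype.card (ι → ℤˣ) : ℝ) = 2 ^ Fintype.card ι := by
    rw [Fintype.card_fun, Fintype.card_units_int]
    push_cast
    rfl
  rw [← hcard] at hK ⊢
  refine sum_rpow_le_of_sum_pow_le (fun _ => norm_nonneg _) (by linarith) (p := p) (by linarith)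
    (by positivity) (hK.trans ?_)
  -- With `p = ⌈r⌉₊`, the dimension is absorbed by one factor `e` per power, and `2p - 1 ≤ 2r + 1 ≤
  -- 3r`; hence the constant `3er`.
  have h1 : (Fintype.card m : ℝ) ≤ Real.exp 1 ^ p := by
    rw [← Real.exp_nat_mul, mul_one]
    exact hr.trans (Real.exp_le_exp.2 hrp)
  gcongr
  calc Fintype.card m * ((2 * p - 1) * s) ^ p
      ≤ Real.exp 1 ^ p * ((3 * r) * s) ^ p := by
        have h2 : (0 : ℝ) ≤ (2 * p - 1) * s := mul_nonneg (by linarith) hs0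
        gcongr
        linarith
    _ = _ := by rw [← mul_pow]; ring

/-- Khintchine for the matrices `Aⱼ²`, whose variance `‖∑ Aⱼ⁴‖` is split by `norm_sum_sq_sq_le` into
the maximum times the original sum. This return of the original sum makes the later self-bounding
argument possible. -/
theorem sum_sign_enorm_sq_rpow_le [DecidableEq ι] {A : ι → Matrix m m ℂ}
    (hA : ∀ i, (A i).IsHermitian) {q r : ℝ} (hq : 1 ≤ q) (hqr : q ≤ r)
    (hr : (Fintype.card m : ℝ) ≤ Real.exp r) :
    ∑ ε : ι → ℤˣ, ‖∑ j, ε j • A j ^ 2‖ₑ ^ q ≤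
      2 ^ Fintype.card ι * (ENNReal.ofReal (3 * Real.exp 1 * r) *
        ((⨆ j, ‖A j ^ 2‖ₑ) * ‖∑ j, A j ^ 2‖ₑ)) ^ (q / 2) := by
  have hr1 : 1 ≤ r := hq.trans hqr
  have hsup : (⨆ j, ‖A j ^ 2‖ₑ) ≠ ⊤ := by
    refine ne_top_of_le_ne_top ?_ (iSup_le fun j => Finset.single_le_sum
      (f := fun j => ‖A j ^ 2‖ₑ) (fun _ _ => zero_le) (Finset.mem_univ j))
    exact ENNReal.sum_ne_top.2 fun _ _ => enorm_ne_top
  have hle := (sum_sign_norm_rpow_le (fun i => (hA i).pow 2) hq hqr hr).trans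
    (mul_le_mul_of_nonneg_left (Real.rpow_le_rpow (by positivity) (mul_le_mul_of_nonneg_left
      (norm_sum_sq_sq_le hA (b := (⨆ j, ‖A j ^ 2‖ₑ).toReal) fun i => by
        rw [← toReal_enorm]
        exact ENNReal.toReal_mono hsup (le_iSup (fun j => ‖A j ^ 2‖ₑ) i))
        (by positivity)) (by positivity : 0 ≤ q / 2)) (by positivity : (0:ℝ) ≤ 2 ^ Fintype.card ι))
  have h := ENNReal.ofReal_le_ofReal hle
  rw [ENNReal.ofReal_sum_of_nonneg (fun _ _ => by positivity),
    ENNReal.ofReal_mul (by positivity), ENNReal.ofReal_pow (by positivity),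
    ← ENNReal.ofReal_rpow_of_nonneg (by positivity) (by positivity),
    ENNReal.ofReal_mul (by positivity : 0 ≤ 3 * Real.exp 1 * r),
    ENNReal.ofReal_mul ENNReal.toReal_nonneg,
    ENNReal.ofReal_toReal hsup, ofReal_norm, ENNReal.ofReal_ofNat] at h
  refine le_of_eq_of_le (Finset.sum_congr rfl fun ε _ => ?_) h
  rw [← ENNReal.ofReal_rpow_of_nonneg (by positivity) (by positivity), ofReal_norm]

end SignAverage

/-! ### Symmetrization -/

section Symmetrization

variable {S : Type*} [MeasurableSpace S] {P : Measure S} [IsProbabilityMeasure P]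

theorem rpow_lintegral_le_lintegral_rpow {f : S → ℝ≥0∞} (hf : Measurable f) {q : ℝ}
    (hq : 1 ≤ q) : (∫⁻ x, f x ∂P) ^ q ≤ ∫⁻ x, f x ^ q ∂P := by
  have hq0 : 0 < q := by linarith
  have h := eLpNorm'_le_eLpNorm'_of_exponent_le one_pos hq P hf.aestronglyMeasurable
  have h' := ENNReal.rpow_le_rpow h hq0.le
  rw [← lintegral_rpow_enorm_eq_rpow_eLpNorm' hq0] at h'
  simpa [eLpNorm'] using h'

variable {ι : Type*} [Fintype ι] {E : Type*} [NormedAddCommGroup E]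

theorem stronglyMeasurable_signed_sum {Y : ι → S → E} (hY : ∀ j, StronglyMeasurable (Y j))
    (ε : ι → ℤˣ) : StronglyMeasurable fun y : ι → S => ∑ j, ε j • Y j (y j) := by
  refine Finset.stronglyMeasurable_fun_sum _ fun j _ => ?_
  have h : StronglyMeasurable fun y : ι → S => Y j (y j) :=
    (hY j).comp_measurable (measurable_pi_apply j)
  rcases Int.units_eq_one_or (ε j) with h' | h' <;> rw [h']
  · simpa using h
  · simpa [Units.neg_smul] using h.fun_neg

/-- Swapping the two copies at the indices where `ε` is `-1` preserves the product law and inserts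
the signs; the two signed sums are then separated by convexity, at the cost `2 ^ q`. -/
theorem lintegral_enorm_sum_sub_rpow_le_signed {Y : ι → S → E}
    (hY : ∀ j, StronglyMeasurable (Y j)) (ε : ι → ℤˣ) {q : ℝ} (hq : 1 ≤ q) :
    ∫⁻ z, ‖∑ j, (Y j (z j).1 - Y j (z j).2)‖ₑ ^ q ∂(Measure.pi fun _ : ι => P.prod P) ≤
      2 ^ q * ∫⁻ y, ‖∑ j, ε j • Y j (y j)‖ₑ ^ q ∂(Measure.pi fun _ : ι => P) := by
  have hq0 : 0 ≤ q := by linarith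
  have hmeas : Measurable fun y : ι → S => ‖∑ j, ε j • Y j (y j)‖ₑ ^ q :=
    (stronglyMeasurable_signed_sum hY ε).enorm.pow_const q
  let σ : ι → S × S → S × S := fun j => if ε j = 1 then id else Prod.swap
  have hσ : MeasurePreserving (fun (z : ι → S × S) j => σ j (z j))
      (Measure.pi fun _ => P.prod P) (Measure.pi fun _ => P.prod P) := by
    refine measurePreserving_pi _ _ fun j => ?_
    by_cases h : ε j = 1
    · simp only [σ, h, if_true]
      exact MeasurePreserving.id _
    · simp only [σ, h, if_false]
      exact Measure.measurePreserving_swap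
  have hfst : MeasurePreserving (fun (z : ι → S × S) j => (z j).1)
      (Measure.pi fun _ => P.prod P) (Measure.pi fun _ => P) :=
    measurePreserving_pi _ _ fun _ => measurePreserving_fst
  have hsnd : MeasurePreserving (fun (z : ι → S × S) j => (z j).2)
      (Measure.pi fun _ => P.prod P) (Measure.pi fun _ => P) :=
    measurePreserving_pi _ _ fun _ => measurePreserving_snd
  have hF : Measurable fun z : ι → S × S => ‖∑ j, (Y j (z j).1 - Y j (z j).2)‖ₑ ^ q := by
    have : StronglyMeasurable fun z : ι → S × S => ∑ j, (Y j (z j).1 - Y j (z j).2) :=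
      Finset.stronglyMeasurable_fun_sum _ fun j _ =>
        ((hY j).comp_measurable (measurable_fst.comp (measurable_pi_apply j))).sub
          ((hY j).comp_measurable (measurable_snd.comp (measurable_pi_apply j)))
    exact this.enorm.pow_const q
  calc ∫⁻ z, ‖∑ j, (Y j (z j).1 - Y j (z j).2)‖ₑ ^ q ∂(Measure.pi fun _ : ι => P.prod P)
      = ∫⁻ z, ‖∑ j, ε j • (Y j (z j).1 - Y j (z j).2)‖ₑ ^ q
          ∂(Measure.pi fun _ : ι => P.prod P) := by
        rw [← hσ.lintegral_comp hF]
        refine lintegral_congr fun z => ?_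
        congr 2
        refine Finset.sum_congr rfl fun j _ => ?_
        rcases Int.units_eq_one_or (ε j) with h | h
        · simp [σ, h]
        · have : σ j = Prod.swap := by simp [σ, h]
          simp only [this]
          rw [h, Units.neg_smul, one_smul, neg_sub, Prod.fst_swap, Prod.snd_swap]
    _ ≤ ∫⁻ z, 2 ^ (q - 1) * (‖∑ j, ε j • Y j (z j).1‖ₑ ^ q + ‖∑ j, ε j • Y j (z j).2‖ₑ ^ q)
          ∂(Measure.pi fun _ : ι => P.prod P) := by
        refine lintegral_mono fun z => ?_
        refine le_trans ?_ (ENNReal.rpow_add_le_mul_rpow_add_rpow _ _ hq)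
        refine ENNReal.rpow_le_rpow ?_ hq0
        simp only [smul_sub, Finset.sum_sub_distrib]
        exact enorm_sub_le
    _ = 2 ^ q * ∫⁻ y, ‖∑ j, ε j • Y j (y j)‖ₑ ^ q ∂(Measure.pi fun _ : ι => P) := by
        have h1 := hmeas.comp hfst.measurable
        have h2 := hmeas.comp hsnd.measurable
        simp only [Function.comp_def] at h1 h2
        rw [lintegral_const_mul _ (h1.fun_add h2), lintegral_add_left h1, hfst.lintegral_comp hmeas,
          hsnd.lintegral_comp hmeas, ← two_mul, ← mul_assoc]
        congr 1
        conv_lhs => rw [← ENNReal.rpow_one 2, ← ENNReal.rpow_mul, one_mul]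
        rw [← ENNReal.rpow_add _ _ (by simp) (by simp), sub_add_cancel]

variable [NormedSpace ℝ E] [CompleteSpace E]

/-- The centered sum is the conditional expectation of the difference of the two copies given the
first one, so Jensen applies. -/
theorem lintegral_enorm_sum_sub_integral_rpow_le {Y : ι → S → E}
    (hY : ∀ j, StronglyMeasurable (Y j)) (hint : ∀ j, Integrable (Y j) P) {q : ℝ} (hq : 1 ≤ q) :
    ∫⁻ y, ‖∑ j, (Y j (y j) - ∫ x, Y j x ∂P)‖ₑ ^ q ∂(Measure.pi fun _ : ι => P) ≤
      ∫⁻ z, ‖∑ j, (Y j (z j).1 - Y j (z j).2)‖ₑ ^ q ∂(Measure.pi fun _ : ι => P.prod P) := by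
  have hq0 : 0 ≤ q := by linarith
  have hF : StronglyMeasurable fun w : (ι → S) × (ι → S) =>
      ∑ j, (Y j (w.1 j) - Y j (w.2 j)) :=
    Finset.stronglyMeasurable_fun_sum _ fun j _ =>
      ((hY j).comp_measurable ((measurable_pi_apply j).comp measurable_fst)).sub
        ((hY j).comp_measurable ((measurable_pi_apply j).comp measurable_snd))
  have hmp := measurePreserving_arrowProdEquivProdArrow S S ι (fun _ => P) (fun _ => P)
  have hrw : ∫⁻ z, ‖∑ j, (Y j (z j).1 - Y j (z j).2)‖ₑ ^ q
      ∂(Measure.pi fun _ : ι => P.prod P) =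
      ∫⁻ y, ∫⁻ y', ‖∑ j, (Y j (y j) - Y j (y' j))‖ₑ ^ q ∂(Measure.pi fun _ : ι => P)
        ∂(Measure.pi fun _ : ι => P) := by
    rw [← lintegral_prod _ (hF.enorm.pow_const q).aemeasurable,
      ← hmp.lintegral_comp (hF.enorm.pow_const q)]
    rfl
  rw [hrw]
  refine lintegral_mono fun y => ?_
  have hint' : ∀ j, Integrable (fun y' : ι → S => Y j (y' j)) (Measure.pi fun _ : ι => P) :=
    fun j => integrable_comp_eval (hint j)
  have heq : ∑ j, (Y j (y j) - ∫ x, Y j x ∂P) =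
      ∫ y', ∑ j, (Y j (y j) - Y j (y' j)) ∂(Measure.pi fun _ : ι => P) := by
    rw [integral_finsetSum _ fun j _ =>
      show Integrable (fun y' : ι → S => Y j (y j) - Y j (y' j)) _ from
        (integrable_const _).sub (hint' j)]
    refine Finset.sum_congr rfl fun j _ => ?_
    rw [integral_sub (integrable_const _) (hint' j), integral_const,
      integral_comp_eval (μ := fun _ : ι => P) (hint j).aestronglyMeasurable]
    simp
  have hmeas : Measurable fun y' : ι → S => ‖∑ j, (Y j (y j) - Y j (y' j))‖ₑ :=
    (hF.comp_measurable measurable_prodMk_left).enorm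
  rw [heq]
  exact (ENNReal.rpow_le_rpow (enorm_integral_le_lintegral_enorm _) hq0).trans
    (rpow_lintegral_le_lintegral_rpow hmeas hq)

/-- **Symmetrization** of the moments of a centered sum, with an average over all signs. -/
theorem lintegral_enorm_sum_sub_integral_rpow_le_sum_sign [DecidableEq ι] {Y : ι → S → E}
    (hY : ∀ j, StronglyMeasurable (Y j)) (hint : ∀ j, Integrable (Y j) P) {q : ℝ} (hq : 1 ≤ q) :
    2 ^ Fintype.card ι *
        ∫⁻ y, ‖∑ j, (Y j (y j) - ∫ x, Y j x ∂P)‖ₑ ^ q ∂(Measure.pi fun _ : ι => P) ≤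
      2 ^ q * ∫⁻ y, ∑ ε : ι → ℤˣ, ‖∑ j, ε j • Y j (y j)‖ₑ ^ q ∂(Measure.pi fun _ : ι => P) := by
  rw [lintegral_finsetSum _ fun ε _ => (stronglyMeasurable_signed_sum hY ε).enorm.pow_const q,
    Finset.mul_sum]
  have h := Finset.sum_le_sum fun (ε : ι → ℤˣ) (_ : ε ∈ Finset.univ) =>
    (lintegral_enorm_sum_sub_integral_rpow_le hY hint hq).trans
      (lintegral_enorm_sum_sub_rpow_le_signed hY ε hq)
  rw [Finset.sum_const, Finset.card_univ, Fintype.card_fun, Fintype.card_units_int,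
    nsmul_eq_mul] at h
  exact_mod_cast h

end Symmetrization

/-! ### Matrix Rosenthal inequality for sums of squares -/

section Rosenthal

theorem ENNReal.iSup_rpow {ι : Sort*} (f : ι → ℝ≥0∞) {q : ℝ} (hq : 0 < q) :
    (⨆ i, f i) ^ q = ⨆ i, f i ^ q :=
  (ENNReal.orderIsoRpow q hq).map_iSup f

/-- If `z > a + k` then `z² > az + kz ≥ a² + kz`. Finiteness of `z` is essential, since `z = ⊤`
satisfies the hypothesis whenever `k ≠ 0`. -/
theorem ENNReal.le_add_of_mul_self_le {z a k : ℝ≥0∞} (hz : z ≠ ⊤)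
    (h : z * z ≤ a * a + k * z) : z ≤ a + k := by
  rcases eq_or_ne a ⊤ with rfl | ha
  · simp
  rcases eq_or_ne k ⊤ with rfl | hk
  · simp
  lift z to NNReal using hz
  lift a to NNReal using ha
  lift k to NNReal using hk
  norm_cast at h ⊢
  have h' : (z : ℝ) * z ≤ a * a + k * z := by exact_mod_cast h
  have : (z : ℝ) ≤ a + k := by
    by_contra! hlt
    have ha := a.coe_nonneg
    have hk := k.coe_nonneg
    nlinarith
  exact_mod_cast this

variable {S : Type*} [MeasurableSpace S] {P : Measure S} [IsProbabilityMeasure P]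
  {m : Type*} [Fintype m] [DecidableEq m] {ι : Type*} [Fintype ι]

theorem lintegral_iSup_enorm_rpow_ne_top_imp_integrable {E : Type*} [NormedAddCommGroup E]
    {Y : ι → S → E} (hY : ∀ j, StronglyMeasurable (Y j)) {q : ℝ} (hq : 1 ≤ q)
    (h : ∫⁻ y, ⨆ j, ‖Y j (y j)‖ₑ ^ q ∂(Measure.pi fun _ : ι => P) ≠ ⊤) (j : ι) :
    Integrable (Y j) P := by
  refine ⟨(hY j).aestronglyMeasurable, ?_⟩
  have hq0 : 0 < q := by linarith
  have h1 : (∫⁻ x, ‖Y j x‖ₑ ∂P) ^ q ≠ ⊤ := by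
    refine ne_top_of_le_ne_top h ?_
    refine (rpow_lintegral_le_lintegral_rpow (hY j).enorm hq).trans ?_
    rw [← (measurePreserving_eval (fun _ : ι => P) j).lintegral_comp ((hY j).enorm.pow_const q)]
    exact lintegral_mono fun y => le_iSup (fun j => ‖Y j (y j)‖ₑ ^ q) j
  rw [HasFiniteIntegral, lt_top_iff_ne_top]
  exact fun h' => h1 (by rw [h', ENNReal.top_rpow_of_pos hq0])

theorem lintegral_enorm_sum_rpow_ne_top {E : Type*} [NormedAddCommGroup E] {Ω : Type*}
    [MeasurableSpace Ω] {μ : Measure Ω} {f : ι → Ω → E} {q : ℝ} (hq : 0 < q)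
    (h : ∫⁻ y, ⨆ j, ‖f j y‖ₑ ^ q ∂μ ≠ ⊤) : ∫⁻ y, ‖∑ j, f j y‖ₑ ^ q ∂μ ≠ ⊤ := by
  have hle : ∀ y, ‖∑ j, f j y‖ₑ ^ q ≤ (Fintype.card ι : ℝ≥0∞) ^ q * ⨆ j, ‖f j y‖ₑ ^ q := by
    intro y
    have h1 : ‖∑ j, f j y‖ₑ ≤ (Fintype.card ι : ℝ≥0∞) * ⨆ j, ‖f j y‖ₑ := by
      refine (enorm_sum_le _ _).trans ?_
      refine (Finset.sum_le_card_nsmul _ _ _ fun j _ => le_iSup (fun j => ‖f j y‖ₑ) j).trans ?_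
      rw [nsmul_eq_mul, Finset.card_univ]
    refine (ENNReal.rpow_le_rpow h1 hq.le).trans ?_
    rw [ENNReal.mul_rpow_of_nonneg _ _ hq.le]
    exact mul_le_mul_right (ENNReal.iSup_rpow _ hq).le _
  have hC : (Fintype.card ι : ℝ≥0∞) ^ q ≠ ⊤ :=
    ENNReal.rpow_ne_top_of_nonneg hq.le (ENNReal.natCast_ne_top _)
  refine ne_top_of_le_ne_top ?_ (lintegral_mono hle)
  rw [lintegral_const_mul' _ _ hC]
  exact ENNReal.mul_ne_top hC h

/-- Centered moments of a sum of squares of independent Hermitian matrices. -/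
theorem lintegral_enorm_sum_sq_sub_integral_rpow_le {A : ι → S → Matrix m m ℂ}
    (hA : ∀ j x, (A j x).IsHermitian) (hAm : ∀ j, StronglyMeasurable (A j))
    (hint : ∀ j, Integrable (fun x => A j x ^ 2) P)
    {q r : ℝ} (hq : 1 ≤ q) (hqr : q ≤ r) (hr : (Fintype.card m : ℝ) ≤ Real.exp r) :
    ∫⁻ y, ‖∑ j, (A j (y j) ^ 2 - ∫ x, A j x ^ 2 ∂P)‖ₑ ^ q ∂(Measure.pi fun _ : ι => P) ≤
      2 ^ q * (ENNReal.ofReal (3 * Real.exp 1 * r) ^ (q / 2) *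
        ((∫⁻ y, ⨆ j, ‖A j (y j) ^ 2‖ₑ ^ q ∂(Measure.pi fun _ : ι => P)) ^ (1 / 2 : ℝ) *
          (∫⁻ y, ‖∑ j, A j (y j) ^ 2‖ₑ ^ q ∂(Measure.pi fun _ : ι => P)) ^ (1 / 2 : ℝ))) := by
  classical
  have hq0 : 0 < q := by linarith
  have hYm : ∀ j, StronglyMeasurable fun x => A j x ^ 2 := fun j => (hAm j).pow 2
  have hYy : ∀ j, StronglyMeasurable fun y : ι → S => A j (y j) ^ 2 := fun j =>
    (hYm j).comp_measurable (measurable_pi_apply j)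
  have hsum : Measurable fun y : ι → S => ‖∑ j, A j (y j) ^ 2‖ₑ ^ q :=
    (Finset.stronglyMeasurable_fun_sum _ fun j _ => hYy j).enorm.pow_const q
  have hmax : Measurable fun y : ι → S => ⨆ j, ‖A j (y j) ^ 2‖ₑ ^ q :=
    Measurable.iSup fun j => (hYy j).enorm.pow_const q
  have h2 : (2 : ℝ≥0∞) ^ Fintype.card ι ≠ 0 := pow_ne_zero _ two_ne_zero
  have h2' : (2 : ℝ≥0∞) ^ Fintype.card ι ≠ ⊤ := ENNReal.pow_ne_top ENNReal.ofNat_ne_top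
  rw [← ENNReal.mul_le_mul_iff_right h2 h2']
  refine (lintegral_enorm_sum_sub_integral_rpow_le_sum_sign hYm hint hq).trans ?_
  rw [mul_left_comm]
  refine mul_le_mul_right ?_ _
  have hpt : ∀ y : ι → S, ∑ ε : ι → ℤˣ, ‖∑ j, ε j • A j (y j) ^ 2‖ₑ ^ q ≤
      (2 ^ Fintype.card ι * ENNReal.ofReal (3 * Real.exp 1 * r) ^ (q / 2)) *
        ((⨆ j, ‖A j (y j) ^ 2‖ₑ ^ q) ^ (1 / 2 : ℝ) *
          (‖∑ j, A j (y j) ^ 2‖ₑ ^ q) ^ (1 / 2 : ℝ)) := fun y => by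
    refine (sum_sign_enorm_sq_rpow_le (fun j => hA j (y j)) hq hqr hr).trans (le_of_eq ?_)
    rw [← ENNReal.iSup_rpow _ hq0, ← ENNReal.rpow_mul, ← ENNReal.rpow_mul, mul_one_div,
      ENNReal.mul_rpow_of_nonneg _ _ (by positivity), ENNReal.mul_rpow_of_nonneg _ _ (by positivity),
      ← mul_assoc]
  refine (lintegral_mono hpt).trans ?_
  rw [lintegral_const_mul _ ((hmax.pow_const _).fun_mul (hsum.pow_const _)), ← mul_assoc]
  refine mul_le_mul_right ?_ _
  exact ENNReal.lintegral_mul_norm_pow_le hmax.aemeasurable hsum.aemeasurable (by norm_num)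
    (by norm_num) (by norm_num)

/-- **Matrix Rosenthal inequality** for sums of squares of independent Hermitian matrices. -/
theorem lintegral_enorm_sum_sq_rpow_le {A : ι → S → Matrix m m ℂ}
    (hA : ∀ j x, (A j x).IsHermitian) (hAm : ∀ j, StronglyMeasurable (A j))
    {q r : ℝ} (hq : 1 ≤ q) (hqr : q ≤ r) (hr : (Fintype.card m : ℝ) ≤ Real.exp r) :
    (∫⁻ y, ‖∑ j, A j (y j) ^ 2‖ₑ ^ q ∂(Measure.pi fun _ : ι => P)) ^ (1 / (2 * q)) ≤
      ‖∑ j, ∫ x, A j x ^ 2 ∂P‖ₑ ^ (1 / 2 : ℝ) +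
        ENNReal.ofReal (2 * √(3 * Real.exp 1 * r)) *
          (∫⁻ y, ⨆ j, ‖A j (y j) ^ 2‖ₑ ^ q ∂(Measure.pi fun _ : ι => P)) ^ (1 / (2 * q)) := by
  have hq0 : 0 < q := by linarith
  have hr0 : 0 < r := by linarith
  have hc : 0 < 3 * Real.exp 1 * r := by positivity
  have hYm : ∀ j, StronglyMeasurable fun x => A j x ^ 2 := fun j => (hAm j).pow 2
  have hYy : ∀ j, StronglyMeasurable fun y : ι → S => A j (y j) ^ 2 := fun j =>
    (hYm j).comp_measurable (measurable_pi_apply j)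
  set M := ∑ j, ∫ x, A j x ^ 2 ∂P with hM
  set B := ∫⁻ y, ⨆ j, ‖A j (y j) ^ 2‖ₑ ^ q ∂(Measure.pi fun _ : ι => P) with hB
  set Z := ∫⁻ y, ‖∑ j, A j (y j) ^ 2‖ₑ ^ q ∂(Measure.pi fun _ : ι => P) with hZ
  -- If `B = ⊤` the right side is infinite. Otherwise the squares are integrable, so the Bochner
  -- integrals in `M` are genuine expectations, and `Z` is finite, as solving the quadratic
  -- inequality requires.
  rcases eq_or_ne B ⊤ with hBt | hBt
  · rw [hBt, ENNReal.top_rpow_of_pos (by positivity), ENNReal.mul_top, add_top]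
    · exact le_top
    · simpa using (by positivity : 0 < 2 * √(3 * Real.exp 1 * r))
  have hint := lintegral_iSup_enorm_rpow_ne_top_imp_integrable hYm hq hBt
  have hZt : Z ≠ ⊤ := lintegral_enorm_sum_rpow_ne_top hq0 hBt
  have hcen := lintegral_enorm_sum_sq_sub_integral_rpow_le hA hAm hint hq hqr hr
  rw [← hB, ← hZ] at hcen
  have htri : Z ^ (1 / q) ≤ ‖M‖ₑ + (∫⁻ y, ‖∑ j, (A j (y j) ^ 2 - ∫ x, A j x ^ 2 ∂P)‖ₑ ^ q
      ∂(Measure.pi fun _ : ι => P)) ^ (1 / q) := by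
    have hmeas : Measurable fun y : ι → S => ‖∑ j, (A j (y j) ^ 2 - ∫ x, A j x ^ 2 ∂P)‖ₑ :=
      (Finset.stronglyMeasurable_fun_sum _ fun j _ =>
        (hYy j).fun_sub stronglyMeasurable_const).enorm
    have h := ENNReal.lintegral_Lp_add_le (μ := Measure.pi fun _ : ι => P)
      (f := fun _ => ‖M‖ₑ) aemeasurable_const hmeas.aemeasurable hq
    rw [lintegral_const, measure_univ, mul_one, ← ENNReal.rpow_mul, mul_one_div_cancel hq0.ne',
      ENNReal.rpow_one] at h
    refine (ENNReal.rpow_le_rpow (lintegral_mono fun y => ENNReal.rpow_le_rpow ?_ hq0.le)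
      (by positivity)).trans h
    rw [Pi.add_apply]
    refine le_trans (le_of_eq ?_) (enorm_add_le _ _)
    rw [Finset.sum_sub_distrib, hM, add_sub_cancel]
  have hexp : ∀ x : ℝ≥0∞, (x ^ (1 / 2 : ℝ)) ^ (1 / q) = x ^ (1 / (2 * q)) := fun x => by
    rw [← ENNReal.rpow_mul]
    congr 1
    field_simp
  have hroot := ENNReal.rpow_le_rpow hcen (by positivity : 0 ≤ 1 / q)
  rw [ENNReal.mul_rpow_of_nonneg _ _ (by positivity), ENNReal.mul_rpow_of_nonneg _ _ (by positivity),
    ENNReal.mul_rpow_of_nonneg _ _ (by positivity), hexp, hexp, ← ENNReal.rpow_mul,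
    ← ENNReal.rpow_mul, mul_one_div_cancel hq0.ne', ENNReal.rpow_one,
    show q / 2 * (1 / q) = 1 / 2 by field_simp,
    ENNReal.ofReal_rpow_of_pos hc, ← Real.sqrt_eq_rpow] at hroot
  have hsq : Z ^ (1 / q) = Z ^ (1 / (2 * q)) * Z ^ (1 / (2 * q)) := by
    rw [← ENNReal.rpow_add_of_nonneg _ _ (by positivity) (by positivity)]
    congr 1
    field_simp
    norm_num
  have hMsq : ‖M‖ₑ = ‖M‖ₑ ^ (1 / 2 : ℝ) * ‖M‖ₑ ^ (1 / 2 : ℝ) := by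
    rw [← ENNReal.rpow_add_of_nonneg _ _ (by positivity) (by positivity)]
    norm_num
  -- The unknown is `z = Z^(1/(2q))`, with `a = ‖M‖^(1/2)` and `k = 2√(3er) · B^(1/(2q))`.
  refine ENNReal.le_add_of_mul_self_le (ENNReal.rpow_ne_top_of_nonneg (by positivity) hZt) ?_
  rw [← hsq, ← hMsq]
  refine htri.trans ((add_le_add_right hroot _).trans (le_of_eq ?_))
  rw [ENNReal.ofReal_mul (by norm_num), ENNReal.ofReal_ofNat]
  ring

end Rosenthal

/-! ### Reverse maximal inequality for independent variables -/

section Maximum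

theorem ENNReal.rpow_sub_one_mul_le (a b : ℝ≥0∞) {q : ℝ} (hq : 1 ≤ q) :
    a ^ (q - 1) * b ≤ a ^ q + b ^ q := by
  have hsplit : ∀ c : ℝ≥0∞, c ^ (q - 1) * c = c ^ q := fun c => by
    conv_lhs => rw [← ENNReal.rpow_one c, ← ENNReal.rpow_mul, one_mul]
    rw [← ENNReal.rpow_add_of_nonneg _ _ (by linarith) zero_le_one, sub_add_cancel]
  rcases le_total a b with h | h
  · calc a ^ (q - 1) * b ≤ b ^ (q - 1) * b := by
          gcongr
      _ = b ^ q := hsplit b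
      _ ≤ _ := le_add_self
  · calc a ^ (q - 1) * b ≤ a ^ (q - 1) * a := by gcongr
      _ = a ^ q := hsplit a
      _ ≤ _ := le_self_add

variable {S : Type*} [MeasurableSpace S] {P : Measure S} [IsProbabilityMeasure P]
  {ι : Type*} [Fintype ι]

theorem lintegral_fintype_prod_eq_prod {f : ι → S → ℝ≥0∞} (hf : ∀ i, Measurable (f i)) :
    ∫⁻ x, ∏ i, f i (x i) ∂(Measure.pi fun _ : ι => P) = ∏ i, ∫⁻ x, f i x ∂P := by
  rw [lintegral_prod_eq_prod_lintegral_of_indepFun Finset.univ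
    (fun (i : ι) (x : ι → S) => f i (x i))
    (iIndepFun_pi (μ := fun _ : ι => P) fun i => (hf i).aemeasurable)
    fun i => (hf i).comp (measurable_pi_apply i)]
  exact Finset.prod_congr rfl fun i _ =>
    (measurePreserving_eval (fun _ : ι => P) i).lintegral_comp (hf i)

/-- The sum of the tails beyond a level which the maximum exceeds with probability at most `1/2` is
controlled by the maximum. -/
theorem sum_lintegral_indicator_le_two_mul {ξ : ι → S → ℝ≥0∞} (hξ : ∀ i, Measurable (ξ i))
    {t : ℝ≥0∞} (h0 : ∫⁻ x, ⨆ i, ξ i (x i) ∂(Measure.pi fun _ : ι => P) ≠ 0)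
    (htop : ∫⁻ x, ⨆ i, ξ i (x i) ∂(Measure.pi fun _ : ι => P) ≠ ⊤)
    (ht : 2 * ∫⁻ x, ⨆ i, ξ i (x i) ∂(Measure.pi fun _ : ι => P) = t) :
    ∑ i, ∫⁻ x in {x | t < ξ i x}, ξ i x ∂P ≤
      2 * ∫⁻ x, ⨆ i, ξ i (x i) ∂(Measure.pi fun _ : ι => P) := by
  classical
  set Q := Measure.pi fun _ : ι => P with hQ
  set M := ∫⁻ x, ⨆ i, ξ i (x i) ∂Q with hM
  have hmax : Measurable fun x : ι → S => ⨆ i, ξ i (x i) :=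
    Measurable.iSup fun i => (hξ i).comp (measurable_pi_apply i)
  have hhi : ∀ i, MeasurableSet {x | t < ξ i x} := fun i => measurableSet_lt measurable_const (hξ i)
  have hlo : ∀ i, MeasurableSet {x | ξ i x ≤ t} := fun i => measurableSet_le (hξ i) measurable_const
  have ht0 : t ≠ 0 := by rw [← ht]; exact mul_ne_zero two_ne_zero h0
  have htt : t ≠ ⊤ := by rw [← ht]; exact ENNReal.mul_ne_top ENNReal.ofNat_ne_top htop
  -- Markov at twice the mean of the maximum: with probability at least `1/2` no variable exceeds
  -- `t`.
  have hhalf : 2⁻¹ ≤ ∏ i, P {x | ξ i x ≤ t} := by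
    rw [← Measure.pi_pi]
    have hcompl : Q (Set.univ.pi fun i => {x | ξ i x ≤ t})ᶜ ≤ 2⁻¹ := by
      calc Q (Set.univ.pi fun i => {x | ξ i x ≤ t})ᶜ ≤ Q {x | t ≤ ⨆ i, ξ i (x i)} := by
            refine measure_mono fun x hx => ?_
            simp only [Set.mem_compl_iff, Set.mem_pi, Set.mem_univ, true_implies,
              Set.mem_ofPred_eq, not_forall, not_le] at hx
            obtain ⟨i, hi⟩ := hx
            exact hi.le.trans (le_iSup (fun i => ξ i (x i)) i)
        _ ≤ M / t := meas_ge_le_lintegral_div hmax.aemeasurable ht0 htt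
        _ = 2⁻¹ := by
            rw [← ht, ENNReal.div_eq_inv_mul, ENNReal.mul_inv (by simp) (by simp), mul_assoc,
              ENNReal.inv_mul_cancel h0 htop, mul_one]
    rw [prob_compl_eq_one_sub (MeasurableSet.univ_pi hlo), tsub_le_iff_left] at hcompl
    rw [← ENNReal.add_le_add_iff_right (a := 2⁻¹) (by simp), ENNReal.inv_two_add_inv_two]
    exact hcompl
  -- The product over `j` is `ξ i` restricted to the event that `i` alone exceeds `t`. By
  -- independence, imposing this on the other indices costs at most a factor 2; these events are
  -- disjoint, so the sum over `i` is at most the maximum.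
  let φ : ι → ι → S → ℝ≥0∞ := fun i j =>
    if j = i then {x | t < ξ i x}.indicator (ξ i) else {x | ξ j x ≤ t}.indicator 1
  have hφ : ∀ i j, Measurable (φ i j) := fun i j => by
    by_cases h : j = i
    · simp only [φ, h, if_true]
      exact (hξ i).indicator (hhi i)
    · simp only [φ, h, if_false]
      exact measurable_one.indicator (hlo j)
  have hsingle : ∀ i, ∫⁻ x in {x | t < ξ i x}, ξ i x ∂P ≤
      2 * ∫⁻ x, ∏ j, φ i j (x j) ∂Q := fun i => by
    rw [hQ, lintegral_fintype_prod_eq_prod (hφ i), ← Finset.mul_prod_erase _ _ (Finset.mem_univ i)]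
    have h1 : ∫⁻ x, φ i i x ∂P = ∫⁻ x in {x | t < ξ i x}, ξ i x ∂P := by
      simp only [φ, if_true]
      exact lintegral_indicator (hhi i) _
    have h2 : 2⁻¹ ≤ ∏ j ∈ Finset.univ.erase i, ∫⁻ x, φ i j x ∂P := by
      refine hhalf.trans ?_
      rw [← Finset.mul_prod_erase _ _ (Finset.mem_univ i)]
      refine (mul_le_of_le_one_left' prob_le_one).trans (le_of_eq ?_)
      refine Finset.prod_congr rfl fun j hj => ?_
      simp only [φ, Finset.ne_of_mem_erase hj, if_false]
      exact (lintegral_indicator_one (hlo j)).symm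
    rw [h1, mul_left_comm]
    calc _ = (∫⁻ x in {x | t < ξ i x}, ξ i x ∂P) * (2 * 2⁻¹) := by
          rw [ENNReal.mul_inv_cancel two_ne_zero ENNReal.ofNat_ne_top, mul_one]
      _ ≤ _ := by gcongr
  calc ∑ i, ∫⁻ x in {x | t < ξ i x}, ξ i x ∂P
      ≤ ∑ i, 2 * ∫⁻ x, ∏ j, φ i j (x j) ∂Q := Finset.sum_le_sum fun i _ => hsingle i
    _ = 2 * ∫⁻ x, ∑ i, ∏ j, φ i j (x j) ∂Q := by
        rw [← Finset.mul_sum, lintegral_finsetSum]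
        exact fun i _ => Finset.measurable_fun_prod _ fun j _ =>
          (hφ i j).comp (measurable_pi_apply j)
    _ ≤ 2 * M := by
        refine mul_le_mul_right (lintegral_mono fun x => ?_) _
        have hzero : ∀ i j, j ≠ i → ¬ ξ j (x j) ≤ t → ∏ k, φ i k (x k) = 0 := fun i j hj hjt =>
          Finset.prod_eq_zero (Finset.mem_univ j) (by simp [φ, hj, hjt])
        have hle : ∀ i, ∏ k, φ i k (x k) ≤ ξ i (x i) := fun i => by
          rw [← Finset.mul_prod_erase _ _ (Finset.mem_univ i)]
          refine (mul_le_mul' ?_ (Finset.prod_le_one' fun j hj => ?_)).trans (mul_one _).le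
          · simp only [φ, if_true]
            exact Set.indicator_le_self' (fun _ _ => zero_le) _
          · simp only [φ, Finset.ne_of_mem_erase hj, if_false]
            exact Set.indicator_le_self' (fun _ _ => zero_le) _
        by_cases h : ∃ i, ¬ ξ i (x i) ≤ t
        · obtain ⟨i, hi⟩ := h
          rw [Finset.sum_eq_single i (fun k _ hk => hzero k i hk.symm hi) (by simp)]
          exact (hle i).trans (le_iSup (fun i => ξ i (x i)) i)
        · push Not at h
          rw [Finset.sum_eq_zero fun i _ => Finset.prod_eq_zero (Finset.mem_univ i)
            (by simp [φ, h i])]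
          exact zero_le

/-- A reverse maximal inequality for independent nonnegative random variables. -/
theorem rpow_mul_sum_lintegral_rpow_le {ξ : ι → S → ℝ≥0∞} (hξ : ∀ i, Measurable (ξ i))
    {q : ℝ} (hq : 1 ≤ q) {R : ℝ≥0∞} (hR : 1 ≤ R) :
    R ^ q * ∑ i, ∫⁻ x, ξ i x ^ q ∂P ≤
      4 * R * (R ^ q * ∫⁻ x, ⨆ i, ξ i (x i) ^ q ∂(Measure.pi fun _ : ι => P) +
        (∑ i, ∫⁻ x, ξ i x ∂P) ^ q) := by
  have hq0 : 0 < q := by linarith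
  have hξq : ∀ i, Measurable fun x => ξ i x ^ q := fun i => (hξ i).pow_const q
  set M := ∫⁻ x, ⨆ i, ξ i (x i) ^ q ∂(Measure.pi fun _ : ι => P) with hM
  set s := ∑ i, ∫⁻ x, ξ i x ∂P with hs
  have hRq : R ^ q ≠ 0 := by
    have : 0 < R := by positivity
    exact (ENNReal.rpow_pos_of_nonneg this hq0.le).ne'
  have hR0 : R ≠ 0 := by positivity
  rcases eq_or_ne M ⊤ with hMt | hMt
  · rw [hMt, ENNReal.mul_top hRq, top_add, ENNReal.mul_top (mul_ne_zero four_ne_zero hR0)]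
    exact le_top
  rcases eq_or_ne M 0 with hM0 | hM0
  · have : ∀ i, ∫⁻ x, ξ i x ^ q ∂P = 0 := fun i => by
      rw [← nonpos_iff_eq_zero, ← hM0,
        ← (measurePreserving_eval (fun _ : ι => P) i).lintegral_comp (hξq i)]
      exact lintegral_mono fun x => le_iSup (fun i => ξ i (x i) ^ q) i
    simp [this]
  -- Truncation level: the part above it sums to at most `2M` by the tail lemma, and below it `ξ^q ≤
  -- t^(q-1) ξ`.
  set t := (2 * M) ^ (1 / q) with ht
  have htq : t ^ q = 2 * M := by
    rw [ht, ← ENNReal.rpow_mul, one_div_mul_cancel hq0.ne', ENNReal.rpow_one]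
  have htail := sum_lintegral_indicator_le_two_mul hξq hM0 hMt htq.symm
  have hbody : ∀ i, ∫⁻ x in {x | t ^ q < ξ i x ^ q}ᶜ, ξ i x ^ q ∂P ≤
      t ^ (q - 1) * ∫⁻ x, ξ i x ∂P := fun i => by
    rw [← lintegral_const_mul _ (hξ i)]
    refine (setLIntegral_mono' (measurableSet_lt measurable_const (hξq i)).compl
      fun x hx => ?_).trans (setLIntegral_le_lintegral _ _)
    have hx' : ξ i x ≤ t := by
      have : ξ i x ^ q ≤ t ^ q := by simpa using hx
      exact (ENNReal.rpow_le_rpow_iff hq0).1 this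
    calc ξ i x ^ q = ξ i x ^ (q - 1) * ξ i x ^ (1 : ℝ) := by
          rw [← ENNReal.rpow_add_of_nonneg _ _ (by linarith) zero_le_one, sub_add_cancel]
      _ ≤ t ^ (q - 1) * ξ i x := by
          rw [ENNReal.rpow_one]
          gcongr
  have hsplit : ∑ i, ∫⁻ x, ξ i x ^ q ∂P ≤ 2 * M + t ^ (q - 1) * s := by
    rw [hs, Finset.mul_sum]
    refine le_trans (le_of_eq ?_) (add_le_add htail (Finset.sum_le_sum fun i _ => hbody i))
    rw [← Finset.sum_add_distrib]
    exact Finset.sum_congr rfl fun i _ =>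
      (lintegral_add_compl _ (measurableSet_lt measurable_const (hξq i))).symm
  have hRsplit : R ^ q = R * R ^ (q - 1) := by
    conv_rhs => rw [← ENNReal.rpow_one R, ← ENNReal.rpow_mul, one_mul]
    rw [← ENNReal.rpow_add_of_nonneg _ _ zero_le_one (by linarith), add_sub_cancel]
  calc R ^ q * ∑ i, ∫⁻ x, ξ i x ^ q ∂P
      ≤ R ^ q * (2 * M + t ^ (q - 1) * s) := by gcongr
    _ = 2 * (R ^ q * M) + R * ((R * t) ^ (q - 1) * s) := by
        rw [ENNReal.mul_rpow_of_nonneg _ _ (by linarith : 0 ≤ q - 1), mul_add]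
        nth_rewrite 2 [hRsplit]
        ring
    -- Only one factor `R` is kept outside; the other `q - 1` are grouped with `t`, so that `s ^ q`
    -- carries `R` instead of `R ^ q`.
    _ ≤ 2 * (R ^ q * M) + R * ((R * t) ^ q + s ^ q) := by
        gcongr
        exact ENNReal.rpow_sub_one_mul_le _ _ hq
    _ = 2 * 1 * (R ^ q * M) + 2 * R * (R ^ q * M) + R * s ^ q := by
        rw [ENNReal.mul_rpow_of_nonneg _ _ hq0.le, htq]
        ring
    _ ≤ 2 * R * (R ^ q * M) + 2 * R * (R ^ q * M) + 4 * R * s ^ q := by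
        gcongr
        exact le_mul_of_one_le_left' (by norm_num)
    _ = _ := by ring

end Maximum

/-! ### Assembling the inequality on the product space -/

section Decoupled

variable {S : Type*} [MeasurableSpace S] {P : Measure S}

/-- Integration of the second-sample Rosenthal inequality over the first sample. -/
theorem sum_lintegral_rpow_le_of_le_add {ι : Type*} [Fintype ι] {g a b : ι → S → ℝ≥0∞}
    (ha : ∀ i, Measurable (a i)) (hb : ∀ i, Measurable (b i)) {q : ℝ} (hq : 1 ≤ q) {K : ℝ≥0∞}
    (h : ∀ i x, g i x ^ (1 / (2 * q)) ≤ a i x ^ (1 / 2 : ℝ) + K * b i x ^ (1 / (2 * q))) :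
    (∑ i, ∫⁻ x, g i x ∂P) ^ (1 / (2 * q)) ≤
      2 * ((∑ i, ∫⁻ x, a i x ^ q ∂P) ^ (1 / (2 * q)) +
        K * (∑ i, ∫⁻ x, b i x ∂P) ^ (1 / (2 * q))) := by
  have hq0 : 0 < q := by linarith
  have h2q : (0 : ℝ) < 2 * q := by linarith
  have hinv : ∀ c : ℝ≥0∞, (c ^ (1 / (2 * q))) ^ (2 * q) = c := fun c => by
    rw [← ENNReal.rpow_mul, one_div_mul_cancel h2q.ne', ENNReal.rpow_one]
  have hinv' : ∀ c : ℝ≥0∞, (c ^ (2 * q)) ^ (1 / (2 * q)) = c := fun c => by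
    rw [← ENNReal.rpow_mul, mul_one_div_cancel h2q.ne', ENNReal.rpow_one]
  have hpt : ∀ i x, g i x ≤ 2 ^ (2 * q) * (a i x ^ q + K ^ (2 * q) * b i x) := fun i x => by
    calc g i x = (g i x ^ (1 / (2 * q))) ^ (2 * q) := (hinv _).symm
      _ ≤ (a i x ^ (1 / 2 : ℝ) + K * b i x ^ (1 / (2 * q))) ^ (2 * q) :=
          ENNReal.rpow_le_rpow (h i x) h2q.le
      _ ≤ 2 ^ (2 * q - 1) * ((a i x ^ (1 / 2 : ℝ)) ^ (2 * q) +
            (K * b i x ^ (1 / (2 * q))) ^ (2 * q)) :=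
          ENNReal.rpow_add_le_mul_rpow_add_rpow _ _ (by linarith)
      _ ≤ 2 ^ (2 * q) * ((a i x ^ (1 / 2 : ℝ)) ^ (2 * q) +
            (K * b i x ^ (1 / (2 * q))) ^ (2 * q)) := by
          gcongr
          · norm_num
          · linarith
      _ = 2 ^ (2 * q) * (a i x ^ q + K ^ (2 * q) * b i x) := by
          rw [ENNReal.mul_rpow_of_nonneg _ _ h2q.le, hinv, ← ENNReal.rpow_mul]
          congr 4
          ring
  have hsum : ∑ i, ∫⁻ x, g i x ∂P ≤
      2 ^ (2 * q) * (∑ i, ∫⁻ x, a i x ^ q ∂P + K ^ (2 * q) * ∑ i, ∫⁻ x, b i x ∂P) := by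
    rw [Finset.mul_sum, ← Finset.sum_add_distrib, Finset.mul_sum]
    refine Finset.sum_le_sum fun i _ => (lintegral_mono (hpt i)).trans (le_of_eq ?_)
    rw [lintegral_const_mul _ (((ha i).pow_const q).fun_add ((hb i).const_mul _)),
      lintegral_add_left ((ha i).pow_const q), lintegral_const_mul _ (hb i)]
  refine (ENNReal.rpow_le_rpow hsum (by positivity)).trans ?_
  rw [ENNReal.mul_rpow_of_nonneg _ _ (by positivity), hinv']
  gcongr
  -- Powers with exponent `1 / (2q) ≤ 1` are subadditive.
  refine (ENNReal.rpow_add_le_add_rpow _ _ (by positivity) ?_).trans (le_of_eq ?_)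
  · rw [div_le_one h2q]
    linarith
  · rw [ENNReal.mul_rpow_of_nonneg _ _ (by positivity), hinv']

variable [IsProbabilityMeasure P]

theorem rpow_half_mul_sum_lintegral_rpow_le {ι : Type*} [Fintype ι] {ξ : ι → S → ℝ≥0∞}
    (hξ : ∀ i, Measurable (ξ i)) {q : ℝ} (hq : 1 ≤ q) {R : ℝ≥0∞} (hR : 1 ≤ R) :
    R ^ (1 / 2 : ℝ) * (∑ i, ∫⁻ x, ξ i x ^ q ∂P) ^ (1 / (2 * q)) ≤
      (4 * R) ^ (1 / (2 * q)) * (R ^ (1 / 2 : ℝ) *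
        (∫⁻ x, ⨆ i, ξ i (x i) ^ q ∂(Measure.pi fun _ : ι => P)) ^ (1 / (2 * q)) +
        (∑ i, ∫⁻ x, ξ i x ∂P) ^ (1 / 2 : ℝ)) := by
  have h2q : (0 : ℝ) < 2 * q := by linarith
  have hexp : ∀ c : ℝ≥0∞, (c ^ q) ^ (1 / (2 * q)) = c ^ (1 / 2 : ℝ) := fun c => by
    rw [← ENNReal.rpow_mul]
    congr 1
    field_simp
  have h := ENNReal.rpow_le_rpow (rpow_mul_sum_lintegral_rpow_le (P := P) hξ hq hR)
    (by positivity : 0 ≤ 1 / (2 * q))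
  rw [ENNReal.mul_rpow_of_nonneg _ _ (by positivity), hexp,
    ENNReal.mul_rpow_of_nonneg _ _ (by positivity)] at h
  refine h.trans ?_
  gcongr
  refine (ENNReal.rpow_add_le_add_rpow _ _ (by positivity) ?_).trans (le_of_eq ?_)
  · rw [div_le_one h2q]
    linarith
  · rw [ENNReal.mul_rpow_of_nonneg _ _ (by positivity), hexp, hexp]

/-- Since `r ≤ q (1 + L)`, it suffices that `q^(1/q) ≤ e` and, by Bernoulli with exponent `1/q ≤ 1`,
that `(1 + L)^(1/q) ≤ 1 + L/q`. -/
theorem four_mul_rpow_le {q r L : ℝ} (hq : 1 ≤ q) (hL : 0 ≤ L) (hr : r = max q (1 + L)) :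
    2 * (4 * r) ^ (1 / (2 * q)) ≤ 4 * Real.exp 1 * √2 * √(1 + L / q) := by
  have hq0 : 0 < q := by linarith
  have hr0 : 0 ≤ r := by rw [hr]; exact hq0.le.trans (le_max_left _ _)
  have hrq : r ≤ q * (1 + L) := by
    rw [hr]
    refine max_le ?_ ?_ <;> nlinarith
  have hqe : q ^ (1 / q) ≤ Real.exp 1 := by
    have h1 : q ≤ Real.exp q := by linarith [Real.add_one_le_exp q]
    refine (Real.rpow_le_rpow hq0.le h1 (by positivity)).trans (le_of_eq ?_)
    rw [← Real.exp_mul, mul_one_div_cancel hq0.ne']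
  have hber : (1 + L) ^ (1 / q) ≤ 1 + L / q := by
    have := rpow_one_add_le_one_add_mul_self (s := L) (p := 1 / q) (by linarith)
      (by positivity) (by rw [div_le_one hq0]; exact hq)
    rwa [one_div_mul_eq_div] at this
  have h4 : (4 : ℝ) ^ (1 / q) ≤ 4 :=
    (Real.rpow_le_rpow_of_exponent_le (by norm_num) (by rw [div_le_one hq0]; exact hq)).trans
      (Real.rpow_one _).le
  have hmain : (4 * r) ^ (1 / q) ≤ 4 * (Real.exp 1 * (1 + L / q)) := by
    calc (4 * r) ^ (1 / q) ≤ (4 * (q * (1 + L))) ^ (1 / q) := by gcongr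
      _ = 4 ^ (1 / q) * (q ^ (1 / q) * (1 + L) ^ (1 / q)) := by
          rw [Real.mul_rpow (by norm_num) (by positivity), Real.mul_rpow hq0.le (by positivity)]
      _ ≤ 4 * (Real.exp 1 * (1 + L / q)) := by gcongr
  have hroot : (4 * r) ^ (1 / (2 * q)) = √((4 * r) ^ (1 / q)) := by
    rw [Real.sqrt_eq_rpow, ← Real.rpow_mul (by positivity)]
    congr 1
    field_simp
  have he : (1 : ℝ) ≤ Real.exp 1 := by linarith [Real.add_one_le_exp 1]
  rw [hroot]
  calc 2 * √((4 * r) ^ (1 / q)) ≤ 2 * √(4 * (Real.exp 1 * (1 + L / q))) := by gcongr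
    _ = 4 * √(Real.exp 1) * √(1 + L / q) := by
        rw [Real.sqrt_mul (by norm_num), Real.sqrt_mul (by positivity),
          show (4 : ℝ) = 2 ^ 2 by norm_num, Real.sqrt_sq (by norm_num)]
        ring
    _ ≤ 4 * Real.exp 1 * √2 * √(1 + L / q) := by
        have h1 : √(Real.exp 1) ≤ Real.exp 1 := Real.sqrt_le_iff.2 ⟨by positivity, by nlinarith⟩
        have h2 : 1 ≤ √2 := Real.one_le_sqrt.2 (by norm_num)
        refine mul_le_mul_of_nonneg_right ?_ (Real.sqrt_nonneg _)
        nlinarith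

theorem rpow_mul_sqrt_le {r T : ℝ} (hr : 1 ≤ r) (hT : 1 ≤ T) :
    r ^ (3 / 2 : ℝ) * (2 * (2 * √(3 * Real.exp 1 * r))) ≤ 4 * Real.exp 1 * √2 * T * r ^ 2 := by
  have hr0 : 0 < r := by linarith
  have he : (2 : ℝ) ≤ Real.exp 1 := by linarith [Real.add_one_le_exp 1]
  have hr2 : r ^ (3 / 2 : ℝ) * √r = r ^ 2 := by
    rw [Real.sqrt_eq_rpow, ← Real.rpow_add hr0, ← Real.rpow_natCast]
    norm_num
  have hs : √(3 * Real.exp 1) ≤ Real.exp 1 * √2 := by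
    refine Real.sqrt_le_iff.2 ⟨by positivity, ?_⟩
    rw [mul_pow, Real.sq_sqrt (by norm_num)]
    nlinarith
  calc r ^ (3 / 2 : ℝ) * (2 * (2 * √(3 * Real.exp 1 * r)))
      = 4 * √(3 * Real.exp 1) * 1 * (r ^ (3 / 2 : ℝ) * √r) := by
        rw [Real.sqrt_mul (by positivity)]
        ring
    _ ≤ 4 * (Real.exp 1 * √2) * T * (r ^ (3 / 2 : ℝ) * √r) := by gcongr
    _ = _ := by rw [hr2]; ring

/-- Accounts for the powers of `r`. In `r^(3/2) = r · r^(1/2)` the half power is spent in the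
reverse maximal inequality with `R = r`, so the first moments keep `r` and the maximum keeps
`r^(3/2)`; the `√r` of Rosenthal raises the `b` term to `r²`. -/
theorem rpow_three_halves_mul_le_of_le_add {ι : Type*} [Fintype ι] {g a b : ι → S → ℝ≥0∞}
    (ha : ∀ i, Measurable (a i)) (hb : ∀ i, Measurable (b i)) {q r L : ℝ} (hq : 1 ≤ q)
    (hL : 0 ≤ L) (hr : r = max q (1 + L))
    (hstep : ∀ i x, g i x ^ (1 / (2 * q)) ≤ a i x ^ (1 / 2 : ℝ) +
      ENNReal.ofReal (2 * √(3 * Real.exp 1 * r)) * b i x ^ (1 / (2 * q)))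
    {G : ℝ≥0∞} (hlhs : G ≤ ∑ i, ∫⁻ x, g i x ∂P) :
    ENNReal.ofReal (r ^ (3 / 2 : ℝ)) * G ^ (1 / (2 * q)) ≤
      ENNReal.ofReal (4 * Real.exp 1 * √2 * √(1 + L / q)) *
        (ENNReal.ofReal r * (∑ i, ∫⁻ x, a i x ∂P) ^ (1 / 2 : ℝ) +
          ENNReal.ofReal (r ^ (3 / 2 : ℝ)) *
            (∫⁻ x, ⨆ i, a i (x i) ^ q ∂(Measure.pi fun _ : ι => P)) ^ (1 / (2 * q)) +
          ENNReal.ofReal (r ^ 2) * (∑ i, ∫⁻ x, b i x ∂P) ^ (1 / (2 * q))) := by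
  have hq0 : 0 < q := by linarith
  have hqr : q ≤ r := by rw [hr]; exact le_max_left _ _
  have hr1 : 1 ≤ r := hq.trans hqr
  have hr0 : 0 < r := by linarith
  have hR : 1 ≤ ENNReal.ofReal r := by rwa [ENNReal.one_le_ofReal]
  have hmink := sum_lintegral_rpow_le_of_le_add (P := P) ha hb hq hstep
  have hmax := rpow_half_mul_sum_lintegral_rpow_le (P := P) ha hq hR
  have h32 : ENNReal.ofReal (r ^ (3 / 2 : ℝ)) =
      ENNReal.ofReal r * ENNReal.ofReal r ^ (1 / 2 : ℝ) := by
    rw [ENNReal.ofReal_rpow_of_pos hr0, ← ENNReal.ofReal_mul hr0.le]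
    congr 1
    nth_rewrite 2 [← Real.rpow_one r]
    rw [← Real.rpow_add hr0]
    norm_num
  have hC : 2 * (4 * ENNReal.ofReal r) ^ (1 / (2 * q)) ≤
      ENNReal.ofReal (4 * Real.exp 1 * √2 * √(1 + L / q)) := by
    refine le_of_eq_of_le ?_ (ENNReal.ofReal_le_ofReal (four_mul_rpow_le hq hL hr))
    rw [ENNReal.ofReal_mul (by norm_num), ← ENNReal.ofReal_rpow_of_pos (by positivity),
      ENNReal.ofReal_mul (by norm_num), ENNReal.ofReal_ofNat, ENNReal.ofReal_ofNat]
  have hK : ENNReal.ofReal (r ^ (3 / 2 : ℝ)) *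
      (2 * ENNReal.ofReal (2 * √(3 * Real.exp 1 * r))) ≤
      ENNReal.ofReal (4 * Real.exp 1 * √2 * √(1 + L / q)) * ENNReal.ofReal (r ^ 2) := by
    have h1 : 1 ≤ √(1 + L / q) := Real.one_le_sqrt.2 (by
      have : 0 ≤ L / q := by positivity
      linarith)
    have h := ENNReal.ofReal_le_ofReal (rpow_mul_sqrt_le hr1 h1)
    rwa [ENNReal.ofReal_mul (by positivity), ENNReal.ofReal_mul (by norm_num : (0 : ℝ) ≤ 2),
      ENNReal.ofReal_mul (by positivity : 0 ≤ 4 * Real.exp 1 * √2 * √(1 + L / q)),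
      ENNReal.ofReal_ofNat] at h
  set C := ENNReal.ofReal (4 * Real.exp 1 * √2 * √(1 + L / q))
  set K := ENNReal.ofReal (2 * √(3 * Real.exp 1 * r))
  set α := (∑ i, ∫⁻ x, a i x ^ q ∂P) ^ (1 / (2 * q))
  set β := (∑ i, ∫⁻ x, b i x ∂P) ^ (1 / (2 * q))
  set s := (∑ i, ∫⁻ x, a i x ∂P) ^ (1 / 2 : ℝ)
  set M := (∫⁻ x, ⨆ i, a i (x i) ^ q ∂(Measure.pi fun _ : ι => P)) ^ (1 / (2 * q))
  set ρ := ENNReal.ofReal (r ^ (3 / 2 : ℝ))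
  set R := ENNReal.ofReal r
  calc _ ≤ ρ * (2 * (α + K * β)) := by
        gcongr
        exact (ENNReal.rpow_le_rpow hlhs (by positivity)).trans hmink
    _ = 2 * R * (R ^ (1 / 2 : ℝ) * α) + ρ * (2 * K) * β := by
        rw [mul_add, mul_add, ← mul_assoc 2 K, ← mul_assoc ρ (2 * K), h32]
        ring
    _ ≤ 2 * R * ((4 * R) ^ (1 / (2 * q)) * (R ^ (1 / 2 : ℝ) * M + s)) +
        C * ENNReal.ofReal (r ^ 2) * β := by gcongr
    _ = 2 * (4 * R) ^ (1 / (2 * q)) * (R * s + ρ * M) + C * ENNReal.ofReal (r ^ 2) * β := by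
        rw [h32]
        ring
    _ ≤ C * (R * s + ρ * M) + C * ENNReal.ofReal (r ^ 2) * β := by gcongr
    _ = _ := by ring

theorem lintegral_lintegral_iSup_le_sum {ι T : Type*} [Fintype ι] [MeasurableSpace T]
    {Q : Measure T} [SFinite Q] {f : ι → S → T → ℝ≥0∞}
    (hf : ∀ i, Measurable fun p : S × T => f i p.1 p.2) :
    ∫⁻ x, ∫⁻ y, ⨆ i, f i (x i) y ∂Q ∂(Measure.pi fun _ : ι => P) ≤
      ∑ i, ∫⁻ x, ∫⁻ y, f i x y ∂Q ∂P := by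
  have hg : ∀ i, Measurable fun x => ∫⁻ y, f i x y ∂Q := fun i => (hf i).lintegral_prod_right'
  calc ∫⁻ x, ∫⁻ y, ⨆ i, f i (x i) y ∂Q ∂(Measure.pi fun _ : ι => P)
      ≤ ∫⁻ x : ι → S, ∑ i, ∫⁻ y, f i (x i) y ∂Q ∂(Measure.pi fun _ : ι => P) := by
        refine lintegral_mono fun x => ?_
        have hx : ∀ i, Measurable fun y => f i (x i) y := fun i =>
          (hf i).comp measurable_prodMk_left
        rw [← lintegral_finsetSum _ fun i _ => hx i]
        exact lintegral_mono fun y => iSup_le fun i =>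
          Finset.single_le_sum (f := fun i => f i (x i) y) (fun _ _ => zero_le) (Finset.mem_univ i)
    _ = _ := by
        have hi : ∀ i, Measurable fun x : ι → S => ∫⁻ y, f i (x i) y ∂Q := fun i =>
          (hg i).comp (measurable_pi_apply i)
        rw [lintegral_finsetSum _ fun i _ => hi i]
        exact Finset.sum_congr rfl fun i _ =>
          (measurePreserving_eval (fun _ : ι => P) i).lintegral_comp (hg i)

section KernelMeasurability

variable {ι E : Type*} [NormedAddCommGroup E] {F : ι → S → S → E}

theorem stronglyMeasurable_uncurry_eval {f : S → S → E}
    (hf : StronglyMeasurable (Function.uncurry f)) (j : ι) :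
    StronglyMeasurable fun p : S × (ι → S) => f p.1 (p.2 j) := by
  have hm : Measurable fun p : S × (ι → S) => (p.1, p.2 j) := by fun_prop
  exact hf.comp_measurable hm

variable [Fintype ι]

theorem measurable_enorm_sum_integral [NormedSpace ℝ E]
    (hF : ∀ j, StronglyMeasurable (Function.uncurry (F j))) :
    Measurable fun x => ‖∑ j, ∫ y, F j x y ∂P‖ₑ :=
  (Finset.stronglyMeasurable_fun_sum _ fun j _ => (hF j).integral_prod_right).enorm

theorem measurable_lintegral_iSup_enorm_rpow
    (hF : ∀ j, StronglyMeasurable (Function.uncurry (F j))) (q : ℝ) :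
    Measurable fun x => ∫⁻ y, ⨆ j, ‖F j x (y j)‖ₑ ^ q ∂(Measure.pi fun _ : ι => P) :=
  (Measurable.iSup fun j =>
    (stronglyMeasurable_uncurry_eval (hF j) j).enorm.pow_const q).lintegral_prod_right'

theorem measurable_enorm_sum_rpow
    (hF : ∀ j, StronglyMeasurable (Function.uncurry (F j))) (q : ℝ) :
    Measurable fun p : S × (ι → S) => ‖∑ j, F j p.1 (p.2 j)‖ₑ ^ q :=
  (Finset.stronglyMeasurable_fun_sum _ fun j _ =>
    stronglyMeasurable_uncurry_eval (hF j) j).enorm.pow_const q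

end KernelMeasurability

theorem rpow_three_halves_mul_le_of_kernel {ι E : Type*} [Fintype ι] [NormedAddCommGroup E]
    [NormedSpace ℝ E] {F : ι → ι → S → S → E}
    (hF : ∀ i j, StronglyMeasurable (Function.uncurry (F i j)))
    {q r L : ℝ} (hq : 1 ≤ q) (hL : 0 ≤ L) (hr : r = max q (1 + L))
    (hstep : ∀ i x,
      (∫⁻ y, ‖∑ j, F i j x (y j)‖ₑ ^ q ∂(Measure.pi fun _ : ι => P)) ^ (1 / (2 * q)) ≤
        ‖∑ j, ∫ y, F i j x y ∂P‖ₑ ^ (1 / 2 : ℝ) + ENNReal.ofReal (2 * √(3 * Real.exp 1 * r)) *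
          (∫⁻ y, ⨆ j, ‖F i j x (y j)‖ₑ ^ q ∂(Measure.pi fun _ : ι => P)) ^ (1 / (2 * q))) :
    ENNReal.ofReal (r ^ (3 / 2 : ℝ)) *
        (∫⁻ x, ∫⁻ y, ⨆ i, ‖∑ j, F i j (x i) (y j)‖ₑ ^ q ∂(Measure.pi fun _ : ι => P)
          ∂(Measure.pi fun _ : ι => P)) ^ (1 / (2 * q)) ≤
      ENNReal.ofReal (4 * Real.exp 1 * √2 * √(1 + L / q)) *
        (ENNReal.ofReal r * (∑ i, ∫⁻ x, ‖∑ j, ∫ y, F i j x y ∂P‖ₑ ∂P) ^ (1 / 2 : ℝ) +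
          ENNReal.ofReal (r ^ (3 / 2 : ℝ)) *
            (∫⁻ x, ⨆ i, ‖∑ j, ∫ y, F i j (x i) y ∂P‖ₑ ^ q ∂(Measure.pi fun _ : ι => P))
              ^ (1 / (2 * q)) +
          ENNReal.ofReal (r ^ 2) *
            (∑ i, ∫⁻ x, ∫⁻ y, ⨆ j, ‖F i j x (y j)‖ₑ ^ q ∂(Measure.pi fun _ : ι => P) ∂P)
              ^ (1 / (2 * q))) := by
  have ha := fun i => measurable_enorm_sum_integral (P := P) (hF i)
  have hb := fun i => measurable_lintegral_iSup_enorm_rpow (P := P) (hF i) q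
  have hle := lintegral_lintegral_iSup_le_sum (P := P) (Q := Measure.pi fun _ : ι => P)
    (f := fun i x y => ‖∑ j, F i j x (y j)‖ₑ ^ q) fun i => measurable_enorm_sum_rpow (hF i) q
  exact rpow_three_halves_mul_le_of_le_add (P := P)
    (g := fun i x => ∫⁻ y, ‖∑ j, F i j x (y j)‖ₑ ^ q ∂(Measure.pi fun _ : ι => P))
    (a := fun i x => ‖∑ j, ∫ y, F i j x y ∂P‖ₑ)
    (b := fun i x => ∫⁻ y, ⨆ j, ‖F i j x (y j)‖ₑ ^ q ∂(Measure.pi fun _ : ι => P))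
    ha hb hq hL hr hstep hle

variable {m : Type*} [Fintype m] [DecidableEq m] {ι : Type*} [Fintype ι]

/-- The moment inequality for squares of decoupled kernels, on the product space. -/
theorem lintegral_iSup_enorm_sum_sq_rpow_le {A : ι → ι → S → S → Matrix m m ℂ}
    (hA : ∀ i j x y, (A i j x y).IsHermitian)
    (hAm : ∀ i j, StronglyMeasurable (Function.uncurry (A i j)))
    {q r L : ℝ} (hq : 1 ≤ q) (hL : 0 ≤ L) (hr : r = max q (1 + L))
    (hd : (Fintype.card m : ℝ) ≤ Real.exp r) :
    ENNReal.ofReal (r ^ (3 / 2 : ℝ)) *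
        (∫⁻ x, ∫⁻ y, ⨆ i, ‖∑ j, A i j (x i) (y j) ^ 2‖ₑ ^ q ∂(Measure.pi fun _ : ι => P)
          ∂(Measure.pi fun _ : ι => P)) ^ (1 / (2 * q)) ≤
      ENNReal.ofReal (4 * Real.exp 1 * √2 * √(1 + L / q)) *
        (ENNReal.ofReal r * (∑ i, ∫⁻ x, ‖∑ j, ∫ y, A i j x y ^ 2 ∂P‖ₑ ∂P) ^ (1 / 2 : ℝ) +
          ENNReal.ofReal (r ^ (3 / 2 : ℝ)) *
            (∫⁻ x, ⨆ i, ‖∑ j, ∫ y, A i j (x i) y ^ 2 ∂P‖ₑ ^ q ∂(Measure.pi fun _ : ι => P))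
              ^ (1 / (2 * q)) +
          ENNReal.ofReal (r ^ 2) *
            (∑ i, ∫⁻ x, ∫⁻ y, ⨆ j, ‖A i j x (y j) ^ 2‖ₑ ^ q ∂(Measure.pi fun _ : ι => P) ∂P)
              ^ (1 / (2 * q))) := by
  have hq0 : 0 < q := by linarith
  have hqr : q ≤ r := by rw [hr]; exact le_max_left _ _
  have hF : ∀ i j, StronglyMeasurable (Function.uncurry fun x y => A i j x y ^ 2) := fun i j =>
    (hAm i j).pow 2
  have hAx : ∀ i x j, StronglyMeasurable (A i j x) := fun i x j =>
    (hAm i j).comp_measurable measurable_prodMk_left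
  have hstep := fun i x => lintegral_enorm_sum_sq_rpow_le (P := P) (fun j y => hA i j x y)
    (hAx i x) hq hqr hd
  exact rpow_three_halves_mul_le_of_kernel hF hq hL hr hstep

end Decoupled

/-! ### Transfer from the samples to product measures -/

section Samples

variable {Ω S : Type*} [MeasurableSpace Ω] [MeasurableSpace S] {μ : Measure Ω}
  {P : Measure S}

theorem IsIIDPairOfSamples.expect₂_eq {n : ℕ} {X : Fin 2 → Fin n → Ω → S} {E : Type*}
    [NormedAddCommGroup E] [NormedSpace ℝ E] (hX : IsIIDPairOfSamples μ P X)
    {f : S → S → E}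
    (hf : StronglyMeasurable (Function.uncurry f)) (i j : Fin n) (ω : Ω) :
    expect₂ μ X (fun x y => f (x i) (y j)) ω = ∫ y, f (X 0 i ω) y ∂P := by
  have hfx : StronglyMeasurable (f (X 0 i ω)) := hf.comp_measurable measurable_prodMk_left
  exact (hX.hasLaw 1 j).integral_comp hfx.aestronglyMeasurable

theorem map_pi_finTwo_prod [IsProbabilityMeasure P] {n : ℕ} :
    (Measure.pi fun _ : Fin 2 × Fin n => P).map
        (fun f => ((fun i => f (0, i), fun i => f (1, i)) : (Fin n → S) × (Fin n → S))) =
      (Measure.pi fun _ : Fin n => P).prod (Measure.pi fun _ : Fin n => P) := by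
  let u : (Fin n → S) × (Fin n → S) → Fin 2 × Fin n → S := fun w p =>
    if p.1 = 0 then w.1 p.2 else w.2 p.2
  have hu : Measurable u := by
    refine measurable_pi_lambda _ fun p => ?_
    by_cases hp : p.1 = 0
    · simp only [u, hp, if_true]
      fun_prop
    · simp only [u, hp, if_false]
      fun_prop
  have hpi : Measure.pi (fun _ : Fin 2 × Fin n => P) =
      ((Measure.pi fun _ : Fin n => P).prod (Measure.pi fun _ : Fin n => P)).map u := by
    refine Measure.pi_eq fun s hs => ?_
    rw [Measure.map_apply hu (MeasurableSet.univ_pi hs)]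
    have hpre : u ⁻¹' Set.univ.pi s =
        (Set.univ.pi fun i => s (0, i)) ×ˢ (Set.univ.pi fun i => s (1, i)) := by
      ext w
      simp [u, Set.mem_pi, Fin.forall_fin_two]
    rw [hpre, Measure.prod_prod, Measure.pi_pi, Measure.pi_pi, Fintype.prod_prod_type,
      Fin.prod_univ_two]
  rw [hpi, Measure.map_map (by fun_prop) hu]
  exact Measure.map_id

variable [IsProbabilityMeasure P]

theorem IsIIDPairOfSamples.hasLaw_pair {n : ℕ} {X : Fin 2 → Fin n → Ω → S}
    (hX : IsIIDPairOfSamples μ P X) :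
    HasLaw (fun ω => ((fun i => X 0 i ω, fun i => X 1 i ω) : (Fin n → S) × (Fin n → S)))
      ((Measure.pi fun _ : Fin n => P).prod (Measure.pi fun _ : Fin n => P)) μ := by
  have h := hX.iIndepFun.hasLaw_pi (μ := fun _ => P) fun (p : Fin 2 × Fin n) => hX.hasLaw p.1 p.2
  have hlaw : HasLaw (fun f : Fin 2 × Fin n → S =>
      ((fun i => f (0, i), fun i => f (1, i)) : (Fin n → S) × (Fin n → S)))
      ((Measure.pi fun _ : Fin n => P).prod (Measure.pi fun _ : Fin n => P))
      (Measure.pi fun _ : Fin 2 × Fin n => P) :=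
    ⟨by fun_prop, map_pi_finTwo_prod⟩
  exact hlaw.fun_comp h

theorem IsIIDPairOfSamples.hasLaw_first {n : ℕ} {X : Fin 2 → Fin n → Ω → S}
    (hX : IsIIDPairOfSamples μ P X) :
    HasLaw (fun ω i => X 0 i ω) (Measure.pi fun _ : Fin n => P) μ :=
  MeasurePreserving.fun_comp_hasLaw measurePreserving_fst hX.hasLaw_pair

theorem stronglyMeasurable_of_measurable_entries {T : Type*} [MeasurableSpace T] {m : Type*}
    [Fintype m] [DecidableEq m] {f : T → Matrix m m ℂ}
    (h : ∀ a b, Measurable fun s => f s a b) : StronglyMeasurable f := by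
  have hf : f = fun s => ∑ a, ∑ b, f s a b • Matrix.single a b (1 : ℂ) := by
    funext s
    conv_lhs => rw [Matrix.matrix_eq_sum_single (f s)]
    simp [Matrix.smul_single]
  rw [hf]
  exact Finset.stronglyMeasurable_fun_sum _ fun a _ => Finset.stronglyMeasurable_fun_sum _
    fun b _ => (h a b).stronglyMeasurable.smul_const _

section Transfer

variable {n : ℕ} {X : Fin 2 → Fin n → Ω → S} {E : Type*} [NormedAddCommGroup E]

theorem IsIIDPairOfSamples.lintegral_iSup_enorm_sum (hX : IsIIDPairOfSamples μ P X)
    {F : Fin n → Fin n → S → S → E}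
    (hF : ∀ i j, StronglyMeasurable (Function.uncurry (F i j))) (q : ℝ) :
    ∫⁻ ω, ⨆ i, ‖∑ j, F i j (X 0 i ω) (X 1 j ω)‖ₑ ^ q ∂μ =
      ∫⁻ x, ∫⁻ y, ⨆ i, ‖∑ j, F i j (x i) (y j)‖ₑ ^ q ∂(Measure.pi fun _ : Fin n => P)
        ∂(Measure.pi fun _ : Fin n => P) := by
  have hm : Measurable fun w : (Fin n → S) × (Fin n → S) =>
      ⨆ i, ‖∑ j, F i j (w.1 i) (w.2 j)‖ₑ ^ q := by
    refine Measurable.iSup fun i => ?_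
    have hi : Measurable fun w : (Fin n → S) × (Fin n → S) => (w.1 i, w.2) := by fun_prop
    exact (measurable_enorm_sum_rpow (hF i) q).comp hi
  rw [← lintegral_prod _ hm.aemeasurable]
  exact hX.hasLaw_pair.lintegral_comp hm.aemeasurable

theorem IsIIDPairOfSamples.lintegral_iSup_enorm (hX : IsIIDPairOfSamples μ P X) (i : Fin n)
    {F : Fin n → S → S → E}
    (hF : ∀ j, StronglyMeasurable (Function.uncurry (F j))) (q : ℝ) :
    ∫⁻ ω, ⨆ j, ‖F j (X 0 i ω) (X 1 j ω)‖ₑ ^ q ∂μ =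
      ∫⁻ x, ∫⁻ y, ⨆ j, ‖F j x (y j)‖ₑ ^ q ∂(Measure.pi fun _ : Fin n => P) ∂P := by
  have hm : Measurable fun p : S × (Fin n → S) => ⨆ j, ‖F j p.1 (p.2 j)‖ₑ ^ q :=
    Measurable.iSup fun j => (stronglyMeasurable_uncurry_eval (hF j) j).enorm.pow_const q
  have hi : Measurable fun w : (Fin n → S) × (Fin n → S) => (w.1 i, w.2) := by fun_prop
  have hm' : Measurable fun w : (Fin n → S) × (Fin n → S) =>
      ⨆ j, ‖F j (w.1 i) (w.2 j)‖ₑ ^ q := hm.comp hi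
  have h := hX.hasLaw_pair.lintegral_comp hm'.aemeasurable
  rw [lintegral_prod _ hm'.aemeasurable] at h
  refine h.trans ?_
  exact (measurePreserving_eval (fun _ : Fin n => P) i).lintegral_comp
    (f := fun x => ∫⁻ y, ⨆ j, ‖F j x (y j)‖ₑ ^ q ∂(Measure.pi fun _ : Fin n => P))
    (measurable_lintegral_iSup_enorm_rpow hF q)

variable [NormedSpace ℝ E]

theorem IsIIDPairOfSamples.lintegral_enorm_sum_integral (hX : IsIIDPairOfSamples μ P X)
    (i : Fin n) {F : Fin n → S → S → E}
    (hF : ∀ j, StronglyMeasurable (Function.uncurry (F j))) :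
    ∫⁻ ω, ‖∑ j, ∫ y, F j (X 0 i ω) y ∂P‖ₑ ∂μ = ∫⁻ x, ‖∑ j, ∫ y, F j x y ∂P‖ₑ ∂P :=
  (hX.hasLaw 0 i).lintegral_comp (f := fun x => ‖∑ j, ∫ y, F j x y ∂P‖ₑ)
    (measurable_enorm_sum_integral hF).aemeasurable

theorem IsIIDPairOfSamples.lintegral_iSup_enorm_sum_integral (hX : IsIIDPairOfSamples μ P X)
    {F : Fin n → Fin n → S → S → E}
    (hF : ∀ i j, StronglyMeasurable (Function.uncurry (F i j))) (q : ℝ) :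
    ∫⁻ ω, ⨆ i, ‖∑ j, ∫ y, F i j (X 0 i ω) y ∂P‖ₑ ^ q ∂μ =
      ∫⁻ x, ⨆ i, ‖∑ j, ∫ y, F i j (x i) y ∂P‖ₑ ^ q ∂(Measure.pi fun _ : Fin n => P) := by
  have hm : Measurable fun x : Fin n → S => ⨆ i, ‖∑ j, ∫ y, F i j (x i) y ∂P‖ₑ ^ q :=
    Measurable.iSup fun i =>
      ((measurable_enorm_sum_integral (P := P) (hF i)).comp (measurable_pi_apply i)).pow_const q
  exact hX.hasLaw_first.lintegral_comp hm.aemeasurable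

end Transfer

end Samples

/-! ### The theorem -/

theorem lemma3p7 {Ω S : Type*} [MeasurableSpace Ω] [MeasurableSpace S]
    (μ : Measure Ω) [IsProbabilityMeasure μ] (P : Measure S) [IsProbabilityMeasure P]
    (n d : ℕ) (hn : 2 ≤ n) (hd : 1 ≤ d)
    (H : Fin n → Fin n → S → S → Matrix (Fin d) (Fin d) ℂ) (hH : IsDegenerateKernelFamily P H)
    (X : Fin 2 → Fin n → Ω → S) (hX : IsIIDPairOfSamples μ P X)
    (q : ℝ) (hq : 1 ≤ q) (r : ℝ) (hr : r = max q (Real.log (Real.exp 1 * d))) :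
    ENNReal.ofReal (r ^ (3 / 2 : ℝ)) *
        (∫⁻ ω, ⨆ i₁, ‖∑ i₂ with i₂ ≠ i₁, H i₁ i₂ (X 0 i₁ ω) (X 1 i₂ ω) ^ 2‖ₑ ^ q ∂μ)
          ^ (1 / (2 * q)) ≤
      ENNReal.ofReal (4 * Real.exp 1 * √2 * √(1 + Real.log d / q)) *
        (ENNReal.ofReal r *
            (∑ i₁, ∫⁻ ω, ‖∑ i₂ with i₂ ≠ i₁,
              expect₂ μ X (fun x y => H i₁ i₂ (x i₁) (y i₂) ^ 2) ω‖ₑ ∂μ) ^ (1 / 2 : ℝ) +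
          ENNReal.ofReal (r ^ (3 / 2 : ℝ)) *
            (∫⁻ ω, ⨆ i₁, ‖∑ i₂ with i₂ ≠ i₁,
              expect₂ μ X (fun x y => H i₁ i₂ (x i₁) (y i₂) ^ 2) ω‖ₑ ^ q ∂μ) ^ (1 / (2 * q)) +
          ENNReal.ofReal (r ^ 2) *
            (∑ i₁, ∫⁻ ω, ⨆ i₂, ⨆ (_ : i₂ ≠ i₁),
              ‖H i₁ i₂ (X 0 i₁ ω) (X 1 i₂ ω) ^ 2‖ₑ ^ q ∂μ) ^ (1 / (2 * q))) := by
  have hq0 : 0 < q := by linarith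
  have hd0 : (1 : ℝ) ≤ d := by exact_mod_cast hd
  have hlog : Real.log (Real.exp 1 * d) = 1 + Real.log d := by
    rw [Real.log_mul (Real.exp_pos _).ne' (by linarith), Real.log_exp]
  have hL : 0 ≤ Real.log d := Real.log_nonneg hd0
  have hdr : (Fintype.card (Fin d) : ℝ) ≤ Real.exp r := by
    rw [Fintype.card_fin]
    calc (d : ℝ) = Real.exp (Real.log d) := (Real.exp_log (by linarith)).symm
      _ ≤ Real.exp r := by
        rw [Real.exp_le_exp, hr, hlog]
        exact le_max_of_le_right (by linarith)
  rw [hlog] at hr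
  -- Zero on the diagonal lets sums and suprema run over all indices: a zero term changes neither a
  -- sum nor a supremum in `ℝ≥0∞`, because `0 ^ q = 0` for `q > 0`.
  set A : Fin n → Fin n → S → S → Matrix (Fin d) (Fin d) ℂ := fun i j x y =>
    if j = i then 0 else H i j x y with hA_def
  have hAne : ∀ i j x y, j ≠ i → A i j x y = H i j x y := fun i j x y h => if_neg h
  have hAeq : ∀ i x y, A i i x y = 0 := fun i x y => if_pos rfl
  have hA : ∀ i j x y, (A i j x y).IsHermitian := fun i j x y => by
    by_cases h : j = i
    · rw [h, hAeq]
      exact Matrix.isHermitian_zero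
    · rw [hAne i j x y h]
      exact hH.isHermitian i j (Ne.symm h) x y
  have hAm : ∀ i j, StronglyMeasurable (Function.uncurry (A i j)) := fun i j => by
    refine stronglyMeasurable_of_measurable_entries fun a b => ?_
    by_cases h : j = i
    · simp only [Function.uncurry_def, h, hAeq]
      exact measurable_const
    · simp only [Function.uncurry_def, hAne _ _ _ _ h]
      exact hH.measurable_entry i j (Ne.symm h) a b
  have hF : ∀ i j, StronglyMeasurable (Function.uncurry fun x y => A i j x y ^ 2) := fun i j =>
    (hAm i j).pow 2
  have hsum : ∀ i (x y : Fin n → S), ∑ j with j ≠ i, H i j (x i) (y j) ^ 2 =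
      ∑ j, A i j (x i) (y j) ^ 2 := fun i x y => by
    rw [Finset.sum_filter]
    refine Finset.sum_congr rfl fun j _ => ?_
    by_cases h : j = i
    · rw [if_neg (not_not.2 h), h, hAeq, zero_pow two_ne_zero]
    · rw [if_pos h, hAne i j _ _ h]
  have hexp : ∀ i ω, ∑ j with j ≠ i, expect₂ μ X (fun x y => H i j (x i) (y j) ^ 2) ω =
      ∑ j, ∫ y, A i j (X 0 i ω) y ^ 2 ∂P := fun i ω => by
    rw [Finset.sum_filter]
    refine Finset.sum_congr rfl fun j _ => ?_
    by_cases h : j = i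
    · simp [h, hAeq]
    · rw [if_pos h, ← hX.expect₂_eq (hF i j) i j ω]
      simp only [hAne i j _ _ h]
  have hsup : ∀ i (x y : Fin n → S), ⨆ j, ⨆ (_ : j ≠ i), ‖H i j (x i) (y j) ^ 2‖ₑ ^ q =
      ⨆ j, ‖A i j (x i) (y j) ^ 2‖ₑ ^ q := fun i x y => by
    refine iSup_congr fun j => ?_
    by_cases h : j = i
    · rw [iSup_neg (not_not.2 h), h, hAeq, zero_pow two_ne_zero, enorm_zero,
        ENNReal.zero_rpow_of_pos hq0, bot_eq_zero]
    · rw [iSup_pos h, hAne i j _ _ h]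
  have hmain := lintegral_iSup_enorm_sum_sq_rpow_le (P := P) hA hAm hq hL hr hdr
  have e1 := hX.lintegral_iSup_enorm_sum hF q
  have e2 := fun i => hX.lintegral_enorm_sum_integral i (hF i)
  have e3 := hX.lintegral_iSup_enorm_sum_integral hF q
  have e4 := fun i => hX.lintegral_iSup_enorm i (hF i) q
  simp only [← e1, ← e2, ← e3, ← e4] at hmain
  have hs := fun i ω => hsum i (fun i => X 0 i ω) (fun i => X 1 i ω)
  have hu := fun i ω => hsup i (fun i => X 0 i ω) (fun i => X 1 i ω)
  simp only [hs, hexp, hu]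
  exact hmain
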